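/- Let $k$ be a field. For a finite quiver $Q$ (finitely many vertices and arrows), let $kQ^a$ be its path algebra: the $k$-vector space on all paths (vertices being the paths of length $0$) with multiplication given by concatenation of paths, graded by length, $kQ^a=\bigoplus_{n\ge 0}kQ^a_n$; write $e_v$ for the idempotent of a vertex $v$. A graded Hopf structure on $kQ^a$ is a Hopf algebra structure on the algebra $kQ^a$ with $\Delta(kQ^a_n)\subseteq\sum_{i+j=n}kQ^a_i\otimes kQ^a_j$, $\varepsilon(kQ^a_n)=0$ for $n\ge 1$ and $S(kQ^a_n)\subseteq kQ^a_n$. A graded quasitriangular Hopf structure is a graded Hopf structure together with an invertible element $R\in kQ^a\otimes kQ^a$ such that $(\Delta\otimes\mathrm{id})(R)=R_{13}R_{23}$, $(\mathrm{id}\otimes\Delta)(R)=R_{13}R_{12}$ and $\Delta^{o}(h)=R\,\Delta(h)\,R^{-1}$ for all $h\in kQ^a$. For a group $G$ and a ramification datum $S=\sum_C S_C\,C$ (a formal sum of the conjugacy classes $C$ of $G$ with coefficients $S_C\in\mathbb N=\{0,1,2,\dots\}$), the Hopf quiver $Q(G,S)$ has vertex set $G$ and, for each $x\in G$, each conjugacy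 class $C$ and each $c\in C$, exactly $S_C$ arrows from $x$ to $cx$. 1. Let $Q$ be a finite quiver. Then $kQ^a$ admits a graded quasitriangular Hopf structure if and only if $Q$ is isomorphic to the Hopf quiver $Q(G,S)$ of some abelian group $G$ with respect to some ramification datum $S$. 2. Let $G$ be a finite abelian group and $S$ a ramification datum of $G$ such that $Q=Q(G,S)$ is connected. Consider the graded quasitriangular Hopf structures on $kQ^a$ with $R\in kQ^a_0\otimes kQ^a_0$ and with $kQ^a_0=(kG)^*$ as Hopf algebras, where $e_g$ is identified with the element of $(kG)^*$ dual to $g$ (that is, $\Delta(e_g)=\sum_{xy=g}e_x\otimes e_y$, $\varepsilon(e_g)=\delta_{g,1}$ and $S(e_g)=e_{g^{-1}}$). Identify two of them if there is an isomorphism of graded Hopf algebras between them which is the identity on $kQ^a_0$ and carries one $R$ to the other. Then the isomorphism classes are in bijection with the skew-symmetric bicharacters of $G$, i.e. the bimultiplicative maps $\chi:G\times G\to k^{\times}$ with $\chi(g,h)\chi(h,g)=1$ for all $g,h\in G$. Under this bijection, $\chi$ corresponds to the class of the structures with $R=\sum_{g,h\in G}\chi(g,h)\,e_g\otimes e_h$.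 -/

import Mathlib

open scoped TensorProduct

universe u v w

noncomputable section

/-! ## Universal R-matrices -/

section RMatrix

variable {k : Type u} [CommRing k] {A : Type v} [Ring A] [Algebra k A]

/-- A Hopf algebra structure on a fixed (associative, unital) algebra `A`: comultiplication and
counit are algebra homomorphisms, and there is an antipode. -/
structure HopfStructure (k : Type u) [CommRing k] (A : Type v) [Ring A] [Algebra k A] where
  comul : A →ₐ[k] A ⊗[k] A
  counit : A →ₐ[k] k
  antipode : A →ₗ[k] A
  coassoc : (Algebra.TensorProduct.assoc k k k A A A).toAlgHom.comp
      ((Algebra.TensorProduct.map comul (AlgHom.id k A)).comp comul) =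
    (Algebra.TensorProduct.map (AlgHom.id k A) comul).comp comul
  rTensor_counit_comp_comul : (Algebra.TensorProduct.map counit (AlgHom.id k A)).comp comul =
    (Algebra.TensorProduct.lid k A).symm.toAlgHom
  lTensor_counit_comp_comul : (Algebra.TensorProduct.map (AlgHom.id k A) counit).comp comul =
    (Algebra.TensorProduct.rid k k A).symm.toAlgHom
  mul_antipode_rTensor_comul :
    LinearMap.mul' k A ∘ₗ antipode.rTensor A ∘ₗ comul.toLinearMap =
      Algebra.linearMap k A ∘ₗ counit.toLinearMap
  mul_antipode_lTensor_comul :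
    LinearMap.mul' k A ∘ₗ antipode.lTensor A ∘ₗ comul.toLinearMap =
      Algebra.linearMap k A ∘ₗ counit.toLinearMap

/-- The Mathlib Hopf algebra given by a Hopf structure on `A`. -/
abbrev HopfStructure.toHopfAlgebra (H : HopfStructure k A) : HopfAlgebra k A :=
  { Bialgebra.ofAlgHom H.comul H.counit H.coassoc H.rTensor_counit_comp_comul
      H.lTensor_counit_comp_comul with
    antipode := H.antipode
    mul_antipode_rTensor_comul := H.mul_antipode_rTensor_comul
    mul_antipode_lTensor_comul := H.mul_antipode_lTensor_comul }

/-- `R ↦ R₁₂ = ∑ R₍₁₎ ⊗ R₍₂₎ ⊗ 1`. -/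
def leg12 (k : Type u) [CommRing k] (A : Type v) [Ring A] [Algebra k A] :
    A ⊗[k] A →ₐ[k] A ⊗[k] (A ⊗[k] A) :=
  Algebra.TensorProduct.map (AlgHom.id k A) Algebra.TensorProduct.includeLeft

/-- `R ↦ R₁₃ = ∑ R₍₁₎ ⊗ 1 ⊗ R₍₂₎`. -/
def leg13 (k : Type u) [CommRing k] (A : Type v) [Ring A] [Algebra k A] :
    A ⊗[k] A →ₐ[k] A ⊗[k] (A ⊗[k] A) :=
  Algebra.TensorProduct.map (AlgHom.id k A) Algebra.TensorProduct.includeRight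

/-- `R ↦ R₂₃ = ∑ 1 ⊗ R₍₁₎ ⊗ R₍₂₎`. -/
def leg23 (k : Type u) [CommRing k] (A : Type v) [Ring A] [Algebra k A] :
    A ⊗[k] A →ₐ[k] A ⊗[k] (A ⊗[k] A) :=
  Algebra.TensorProduct.includeRight

/-- `R` is a universal R-matrix (a quasitriangular structure) of the Hopf algebra `H`:
`R` is invertible, `(Δ ⊗ id)(R) = R₁₃ R₂₃`, `(id ⊗ Δ)(R) = R₁₃ R₁₂` and
`Δᵒ(h) = R Δ(h) R⁻¹` for all `h`. -/
structure HopfStructure.IsUniversalRMatrix (H : HopfStructure k A) (R : (A ⊗[k] A)ˣ) : Prop where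
  comul_left : Algebra.TensorProduct.assoc k k k A A A
      (Algebra.TensorProduct.map H.comul (AlgHom.id k A) (R : A ⊗[k] A)) =
    leg13 k A R * leg23 k A R
  comul_right : Algebra.TensorProduct.map (AlgHom.id k A) H.comul (R : A ⊗[k] A) =
    leg13 k A R * leg12 k A R
  comul_op : ∀ h : A, Algebra.TensorProduct.comm k A A (H.comul h) =
    (R : A ⊗[k] A) * H.comul h * ((R⁻¹ : (A ⊗[k] A)ˣ) : A ⊗[k] A)

/-- For subspaces `p`, `q` of `A`, the subspace `p ⊗ q` of `A ⊗ A`. -/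
def tensorSub (p q : Submodule k A) : Submodule k (A ⊗[k] A) :=
  LinearMap.range (TensorProduct.map p.subtype q.subtype)

/-- The Hopf structure respects the grading `A = ⨁ₙ 𝒜 n`. -/
structure HopfStructure.IsGraded (H : HopfStructure k A) (𝒜 : ℕ → Submodule k A) : Prop where
  comul_mem : ∀ n, ∀ a ∈ 𝒜 n,
    H.comul a ∈ ⨆ (i : ℕ) (j : ℕ) (_ : i + j = n), tensorSub (𝒜 i) (𝒜 j)
  counit_eq_zero : ∀ n, n ≠ 0 → ∀ a ∈ 𝒜 n, H.counit a = 0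
  antipode_mem : ∀ n, ∀ a ∈ 𝒜 n, H.antipode a ∈ 𝒜 n

end RMatrix

/-! ## Path algebras -/

/-- A path of the quiver `V`, with its source and target (vertices are the paths of length 0). -/
structure QPath (V : Type v) [Quiver.{w} V] where
  src : V
  tgt : V
  path : Quiver.Path src tgt

namespace QPath

variable {V : Type v} [Quiver.{w} V]

/-- The trivial path at a vertex. -/
def nil (a : V) : QPath V := ⟨a, a, Quiver.Path.nil⟩

/-- The path consisting of a single arrow. -/
def arrow {a b : V} (e : a ⟶ b) : QPath V := ⟨a, b, e.toPath⟩

/-- The length of a path. -/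
def length (p : QPath V) : ℕ := p.path.length

/-- The concatenation `p q` (first `q`, then `p`), for paths with `s(p) = t(q)`. -/
def concat (p q : QPath V) (h : q.tgt = p.src) : QPath V :=
  ⟨q.src, p.tgt, q.path.comp (p.path.cast h.symm rfl)⟩

theorem nil_concat (a : V) (q : QPath V) (h : q.tgt = a) : concat (nil a) q h = q := by
  subst h; rfl

theorem concat_nil (a : V) (p : QPath V) (h : a = p.src) : concat p (nil a) h = p := by
  subst h; simp [concat, nil]

theorem concat_assoc (p q r : QPath V) (h : q.tgt = p.src) (h' : r.tgt = q.src) :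
    concat (concat p q h) r h' = concat p (concat q r h') h := by
  obtain ⟨a, b, p⟩ := p
  obtain ⟨c, d, q⟩ := q
  obtain ⟨e, f, r⟩ := r
  dsimp at h h'
  subst h h'
  simp [concat]

end QPath

/-- The path algebra of `V` over `k`: the free `k`-module on the paths of `V`, with the product
given by concatenation of paths. -/
def PathAlgebra (k : Type u) [CommRing k] (V : Type v) [Quiver.{w} V] : Type _ := QPath V →₀ k

namespace PathAlgebra

variable {k : Type u} [CommRing k] {V : Type v} [Quiver.{w} V]

instance : AddCommGroup (PathAlgebra k V) := inferInstanceAs (AddCommGroup (QPath V →₀ k))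

instance : Module k (PathAlgebra k V) := inferInstanceAs (Module k (QPath V →₀ k))

/-- The basis element of the path algebra given by a path. -/
def of (k : Type u) [CommRing k] {V : Type v} [Quiver.{w} V] (p : QPath V) : PathAlgebra k V :=
  Finsupp.single p (1 : k)

/-- The idempotent `e_a` given by a vertex `a`. -/
def vertex (k : Type u) [CommRing k] {V : Type v} [Quiver.{w} V] (a : V) : PathAlgebra k V :=
  of k (QPath.nil a)

/-- The paths form a basis of the path algebra. -/
def basis (k : Type u) [CommRing k] (V : Type v) [Quiver.{w} V] :
    Module.Basis (QPath V) k (PathAlgebra k V) :=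
  ⟨LinearEquiv.refl k (QPath V →₀ k)⟩

theorem basis_apply (p : QPath V) : basis k V p = of k p := rfl

open Classical in
/-- The product of two paths: their concatenation if `s(p) = t(q)`, and `0` otherwise. -/
def pathMul (k : Type u) [CommRing k] {V : Type v} [Quiver.{w} V] (p q : QPath V) :
    PathAlgebra k V :=
  if h : q.tgt = p.src then of k (p.concat q h) else 0

/-- The bilinear extension of the product of paths. -/
def mulHom (k : Type u) [CommRing k] (V : Type v) [Quiver.{w} V] :
    PathAlgebra k V →ₗ[k] PathAlgebra k V →ₗ[k] PathAlgebra k V :=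
  (basis k V).constr k fun p => (basis k V).constr k fun q => pathMul k p q

theorem mulHom_of (p q : QPath V) : mulHom k V (of k p) (of k q) = pathMul k p q := by
  simp [mulHom, ← basis_apply, Module.Basis.constr_basis]

theorem mulHom_assoc (x y z : PathAlgebra k V) :
    mulHom k V (mulHom k V x y) z = mulHom k V x (mulHom k V y z) := by
  suffices h1 : (mulHom k V).flip z ∘ₗ (mulHom k V).flip y = (mulHom k V).flip (mulHom k V y z) from
    LinearMap.congr_fun h1 x
  refine (basis k V).ext fun p => ?_
  suffices h2 : (mulHom k V).flip z ∘ₗ mulHom k V (of k p) =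
      mulHom k V (of k p) ∘ₗ (mulHom k V).flip z from LinearMap.congr_fun h2 y
  refine (basis k V).ext fun q => ?_
  suffices h3 : mulHom k V (mulHom k V (of k p) (of k q)) =
      mulHom k V (of k p) ∘ₗ mulHom k V (of k q) from LinearMap.congr_fun h3 z
  refine (basis k V).ext fun r => ?_
  simp only [basis_apply, LinearMap.comp_apply, mulHom_of]
  by_cases h : q.tgt = p.src <;> by_cases h' : r.tgt = q.src
  · have h1 : r.tgt = (p.concat q h).src := h'
    have h2 : (q.concat r h').tgt = p.src := h
    simp only [pathMul, dif_pos h, dif_pos h', mulHom_of, dif_pos h1, dif_pos h2]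
    rw [QPath.concat_assoc p q r h h']
  · have h1 : ¬ r.tgt = (p.concat q h).src := h'
    simp [pathMul, dif_pos h, dif_neg h', mulHom_of, dif_neg h1]
  · have h2 : ¬ (q.concat r h').tgt = p.src := h
    simp [pathMul, dif_neg h, dif_pos h', mulHom_of, dif_neg h2]
  · simp [pathMul, dif_neg h, dif_neg h']

variable [Fintype V]

theorem mulHom_one_left (x : PathAlgebra k V) :
    mulHom k V (∑ a : V, vertex k a) x = x := by
  suffices h : mulHom k V (∑ a : V, vertex k a) = LinearMap.id from LinearMap.congr_fun h x
  refine (basis k V).ext fun p => ?_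
  simp only [basis_apply, map_sum, LinearMap.sum_apply, vertex, mulHom_of, LinearMap.id_apply]
  rw [Finset.sum_eq_single p.tgt]
  · have h : p.tgt = (QPath.nil p.tgt).src := rfl
    rw [pathMul, dif_pos h]
    exact congrArg (of k) (QPath.nil_concat _ p rfl)
  · intro b _ hb
    exact dif_neg fun h => hb h.symm
  · simp

theorem mulHom_one_right (x : PathAlgebra k V) :
    mulHom k V x (∑ a : V, vertex k a) = x := by
  suffices h : (mulHom k V).flip (∑ a : V, vertex k a) = LinearMap.id from
    LinearMap.congr_fun h x
  refine (basis k V).ext fun p => ?_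
  simp only [basis_apply, map_sum, LinearMap.sum_apply, LinearMap.flip_apply, vertex, mulHom_of,
    LinearMap.id_apply]
  rw [Finset.sum_eq_single p.src]
  · have h : (QPath.nil p.src).tgt = p.src := rfl
    rw [pathMul, dif_pos h]
    exact congrArg (of k) (QPath.concat_nil _ p rfl)
  · intro b _ hb
    exact dif_neg fun h => hb h
  · simp

instance : Ring (PathAlgebra k V) :=
  { (inferInstance : AddCommGroup (PathAlgebra k V)) with
    mul := fun x y => mulHom k V x y
    one := ∑ a : V, vertex k a
    left_distrib := fun x y z => map_add (mulHom k V x) y z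
    right_distrib := fun x y z => LinearMap.map_add₂ (mulHom k V) x y z
    zero_mul := fun x => LinearMap.map_zero₂ (mulHom k V) x
    mul_zero := fun x => map_zero (mulHom k V x)
    mul_assoc := mulHom_assoc
    one_mul := mulHom_one_left
    mul_one := mulHom_one_right }

instance : Algebra k (PathAlgebra k V) :=
  Algebra.ofModule (fun c x y => LinearMap.map_smul₂ (mulHom k V) c x y)
    (fun c x y => map_smul (mulHom k V x) c y)

/-- The span of the paths of length `n`. -/
def grade (k : Type u) [CommRing k] (V : Type v) [Quiver.{w} V] (n : ℕ) :
    Submodule k (PathAlgebra k V) :=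
  Submodule.span k {x | ∃ p : QPath V, p.length = n ∧ x = of k p}

end PathAlgebra

/-! ## Hopf quivers -/

/-- The vertex set of the Hopf quiver `Q(G, S)` of a group `G` with respect to a ramification
datum `S`, i.e. a family of natural numbers indexed by the conjugacy classes of `G`. -/
def HopfQuiver (G : Type v) [Group G] (_S : ConjClasses G → ℕ) : Type v := G

/-- In `Q(G, S)` there are `S C` arrows from `x` to `c x`, for every `x : G`, every conjugacy
class `C` and every `c ∈ C`; in other words the number of arrows from `x` to `y` is the value of
`S` at the class of `y x⁻¹`. -/
instance (G : Type v) [Group G] (S : ConjClasses G → ℕ) : Quiver.{0} (HopfQuiver G S) where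
  Hom x y := Fin (S (ConjClasses.mk ((show G from y) * (show G from x)⁻¹)))

instance (G : Type v) [Group G] [Fintype G] (S : ConjClasses G → ℕ) : Fintype (HopfQuiver G S) :=
  inferInstanceAs (Fintype G)

/-- An isomorphism of quivers. -/
structure QuiverIso (V : Type*) [Quiver V] (W : Type*) [Quiver W] where
  vertexEquiv : V ≃ W
  arrowEquiv : ∀ a b : V, (a ⟶ b) ≃ (vertexEquiv a ⟶ vertexEquiv b)

/-- A quiver is connected if it has a vertex, and any two vertices are joined by a path in the
underlying unoriented graph. -/
def IsConnectedQuiver (V : Type*) [Quiver V] : Prop :=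
  Nonempty V ∧ ∀ a b : V, Nonempty (@Quiver.Path (Quiver.Symmetrify V) _ a b)

/-! ## Graded quasitriangular structures on path algebras -/

/-- A graded quasitriangular Hopf structure on the path algebra of `V`: a graded Hopf structure
together with a universal R-matrix. -/
structure GradedQuasitriangular (k : Type u) [CommRing k] (V : Type v) [Quiver.{w} V]
    [Fintype V] where
  hopf : HopfStructure k (PathAlgebra k V)
  isGraded : hopf.IsGraded (PathAlgebra.grade k V)
  R : (PathAlgebra k V ⊗[k] PathAlgebra k V)ˣ
  isUniversalRMatrix : hopf.IsUniversalRMatrix R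

/-- For `g : G`, the idempotent `e_g` of the path algebra of `Q(G, S)`. -/
def eVert (k : Type u) [CommRing k] {G : Type v} [Group G] (S : ConjClasses G → ℕ) (g : G) :
    PathAlgebra k (HopfQuiver G S) :=
  PathAlgebra.vertex k (show HopfQuiver G S from g)

/-- The graded quasitriangular Hopf structures on the path algebra of `Q(G, S)` with degree zero
part equal to the dual Hopf algebra `(kG)^*`, where the idempotent `e_g` is identified with the
element of `(kG)^*` dual to `g`, and with `R` concentrated in degree zero. -/
structure HopfQuiverStructure (k : Type u) [CommRing k] (G : Type v) [Group G] [Fintype G]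
    (S : ConjClasses G → ℕ) extends GradedQuasitriangular k (HopfQuiver G S) where
  comul_vertex : ∀ g : G, hopf.comul (eVert k S g) =
    ∑ x : G, eVert k S x ⊗ₜ[k] eVert k S (x⁻¹ * g)
  counit_vertex_one : hopf.counit (eVert k S 1) = 1
  counit_vertex_of_ne : ∀ g : G, g ≠ 1 → hopf.counit (eVert k S g) = 0
  antipode_vertex : ∀ g : G, hopf.antipode (eVert k S g) = eVert k S g⁻¹
  R_mem : (R : PathAlgebra k (HopfQuiver G S) ⊗[k] PathAlgebra k (HopfQuiver G S)) ∈
    tensorSub (PathAlgebra.grade k (HopfQuiver G S) 0) (PathAlgebra.grade k (HopfQuiver G S) 0)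

namespace HopfQuiverStructure

variable {k : Type u} [CommRing k] {G : Type v} [Group G] [Fintype G] {S : ConjClasses G → ℕ}

/-- An isomorphism of graded quasitriangular Hopf algebras which is the identity on the degree
zero part `(kG)^*`. -/
structure IsIso (X Y : HopfQuiverStructure k G S)
    (φ : PathAlgebra k (HopfQuiver G S) ≃ₐ[k] PathAlgebra k (HopfQuiver G S)) : Prop where
  map_grade : ∀ n, (PathAlgebra.grade k (HopfQuiver G S) n).map φ.toLinearMap =
    PathAlgebra.grade k (HopfQuiver G S) n
  map_vertex : ∀ g : G, φ (eVert k S g) = eVert k S g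
  map_comul : ∀ a, Algebra.TensorProduct.congr φ φ (X.hopf.comul a) = Y.hopf.comul (φ a)
  map_counit : ∀ a, Y.hopf.counit (φ a) = X.hopf.counit a
  map_antipode : ∀ a, φ (X.hopf.antipode a) = Y.hopf.antipode (φ a)
  map_R : Algebra.TensorProduct.congr φ φ
    (X.R : PathAlgebra k (HopfQuiver G S) ⊗[k] PathAlgebra k (HopfQuiver G S)) = Y.R

theorem IsIso.refl (X : HopfQuiverStructure k G S) : IsIso X X AlgEquiv.refl where
  map_grade n := Submodule.map_id _
  map_vertex _ := rfl
  map_comul a := by simp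
  map_counit _ := rfl
  map_antipode _ := rfl
  map_R := by simp

theorem IsIso.symm {X Y : HopfQuiverStructure k G S}
    {φ : PathAlgebra k (HopfQuiver G S) ≃ₐ[k] PathAlgebra k (HopfQuiver G S)}
    (h : IsIso X Y φ) : IsIso Y X φ.symm where
  map_grade n := by
    conv_lhs => rw [← h.map_grade n]
    rw [← Submodule.map_comp]
    convert Submodule.map_id _
    ext x
    simp
  map_vertex g := by rw [AlgEquiv.symm_apply_eq, h.map_vertex]
  map_comul a := by
    change (Algebra.TensorProduct.congr φ φ).symm _ = _
    rw [AlgEquiv.symm_apply_eq, h.map_comul]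
    simp
  map_counit a := by rw [← h.map_counit]; simp
  map_antipode a := by rw [AlgEquiv.symm_apply_eq, h.map_antipode]; simp
  map_R := by
    change (Algebra.TensorProduct.congr φ φ).symm _ = _
    rw [AlgEquiv.symm_apply_eq, h.map_R]

theorem IsIso.trans {X Y Z : HopfQuiverStructure k G S}
    {φ ψ : PathAlgebra k (HopfQuiver G S) ≃ₐ[k] PathAlgebra k (HopfQuiver G S)}
    (h : IsIso X Y φ) (h' : IsIso Y Z ψ) : IsIso X Z (φ.trans ψ) where
  map_grade n := by
    have : (φ.trans ψ).toLinearMap = ψ.toLinearMap ∘ₗ φ.toLinearMap := rfl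
    rw [this, Submodule.map_comp, h.map_grade, h'.map_grade]
  map_vertex g := by simp [h.map_vertex, h'.map_vertex]
  map_comul a := by
    rw [Algebra.TensorProduct.congr_trans, AlgEquiv.trans_apply, h.map_comul, h'.map_comul]
    rfl
  map_counit a := by simp [h'.map_counit, h.map_counit]
  map_antipode a := by simp [h'.map_antipode, h.map_antipode]
  map_R := by
    rw [Algebra.TensorProduct.congr_trans, AlgEquiv.trans_apply, h.map_R, h'.map_R]

/-- Two structures are equivalent if they are isomorphic by an isomorphism which is the identity
on the degree zero part `(kG)^*`. -/
instance isoSetoid (k : Type u) [CommRing k] (G : Type v) [Group G] [Fintype G]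
    (S : ConjClasses G → ℕ) : Setoid (HopfQuiverStructure k G S) where
  r X Y := ∃ φ, IsIso X Y φ
  iseqv :=
    { refl := fun X => ⟨_, IsIso.refl X⟩
      symm := fun ⟨_, h⟩ => ⟨_, h.symm⟩
      trans := fun ⟨_, h⟩ ⟨_, h'⟩ => ⟨_, h.trans h'⟩ }

end HopfQuiverStructure

/-- The skew-symmetric bicharacters of `G` with values in `k`: the bimultiplicative maps
`χ : G × G → kˣ` with `χ(g, h) χ(h, g) = 1` for all `g`, `h`. -/
abbrev SkewBicharacter (k : Type u) [CommRing k] (G : Type v) [Group G] :=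
  {χ : G →* G →* kˣ // ∀ g h : G, χ g h * χ h g = 1}

end

/-! The argument rests on the characters of the path algebra that kill every arrow. They are exactly
the `char k v`, one for each vertex (`exists_eq_char`). The grading makes their convolution products
characters of the same kind, and the counit is one of them. Pairing Δᵒ(h) = R Δ(h) R⁻¹ with two such
characters lands in the commutative field `k`, where R cancels. So convolution is commutative and,
with the antipode, turns the vertices into an abelian group (`exists_commGroup_isCharGroup`).

Contracting the left leg of Δ with `char k g` gives an algebra automorphism `shift H g` of degree
zero that sends e_v to e_{g⁻¹v}. It carries the arrow space from a to b onto the one from g⁻¹a to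
g⁻¹b. The number of arrows therefore depends only on a⁻¹b, which is the Hopf quiver condition.
Conversely, on a Hopf quiver of an abelian group the arrows can be translated, and each
skew-symmetric bicharacter χ gives a structure with Δ(e) = ∑_g (e_g ⊗ g⁻¹e + χ(g, d) g⁻¹e ⊗ e_g),
where d is the target of e divided by its source. For existence χ = 1 is enough.

For the classification, an R of degree zero is diagonal, and the two coproduct axioms say that its
entries form a bicharacter χ (`rBichar`). Contracting quasi-cocommutativity on one side shows that
right translation is χ(g, d) times left translation (`evalRight_comul`). Contracting on the other
side then gives χ(g, d) χ(d, g) = 1 (`skew_of_arrow`). Connectedness means that the degrees d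
generate G, so χ is skew-symmetric everywhere. Two structures with the same χ differ only in their
left translations. Moving each arrow to source 1 by one structure and back by the other is the
required isomorphism (`transfer`, `comul_transfer`). -/

noncomputable section

/-- An arrow of a quiver, together with its source and target. -/
structure QArrow (V : Type v) [Quiver.{w} V] where
  src : V
  tgt : V
  hom : src ⟶ tgt

/-! ### Path algebras: generators, universal property, vertex characters -/

namespace PathAlgebra

section Basic

variable {k : Type u} [CommRing k] {V : Type v} [Quiver.{w} V]

/-- The basis element of the path algebra given by an arrow. -/
def arrow (k : Type u) [CommRing k] {V : Type v} [Quiver.{w} V] (e : QArrow V) :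
    PathAlgebra k V :=
  of k (QPath.arrow e.hom)

/-- The product of the images of the arrows of a path. -/
def evalPath {B : Type*} [Mul B] (f : V → B) (m : QArrow V → B) {a b : V} : Quiver.Path a b → B
  | .nil => f a
  | .cons p e => m ⟨_, _, e⟩ * evalPath f m p

theorem vertex_mem_grade (v : V) : vertex k v ∈ grade k V 0 :=
  Submodule.subset_span ⟨QPath.nil v, rfl, rfl⟩

theorem arrow_mem_grade (e : QArrow V) : arrow k e ∈ grade k V 1 :=
  Submodule.subset_span ⟨QPath.arrow e.hom, rfl, rfl⟩

theorem grade_zero_eq : grade k V 0 = Submodule.span k (Set.range (vertex k)) := by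
  refine congrArg _ (Set.ext fun x => ⟨?_, ?_⟩)
  · rintro ⟨⟨a, b, p⟩, hp, rfl⟩
    cases p with
    | nil => exact ⟨a, rfl⟩
    | cons p e => exact absurd hp (Nat.succ_ne_zero _)
  · rintro ⟨v, rfl⟩
    exact ⟨QPath.nil v, rfl, rfl⟩

theorem grade_one_eq : grade k V 1 = Submodule.span k (Set.range (arrow k)) := by
  refine congrArg _ (Set.ext fun x => ⟨?_, ?_⟩)
  · rintro ⟨⟨a, b, p⟩, hp, rfl⟩
    cases p with
    | nil => exact absurd hp (by simp [QPath.length])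
    | cons p e =>
      cases p with
      | nil => exact ⟨⟨_, _, e⟩, rfl⟩
      | cons p e => exact absurd hp (by simp [QPath.length])
  · rintro ⟨e, rfl⟩
    exact ⟨QPath.arrow e.hom, rfl, rfl⟩

theorem linearIndependent_arrow : LinearIndependent k (arrow k : QArrow V → _) := by
  have h : Function.Injective fun e : QArrow V => QPath.arrow e.hom := by
    rintro ⟨a, b, e⟩ ⟨c, d, e'⟩ h
    simp only [QPath.arrow, QPath.mk.injEq] at h
    obtain ⟨rfl, rfl, h⟩ := h
    simpa [Quiver.Hom.toPath] using h
  exact (basis k V).linearIndependent.comp _ h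

variable [Fintype V]

theorem of_mul_of (p q : QPath V) : of k p * of k q = pathMul k p q :=
  mulHom_of p q

theorem one_eq_sum : (1 : PathAlgebra k V) = ∑ a : V, vertex k a := rfl

open Classical in
theorem vertex_mul_of (v : V) (p : QPath V) :
    vertex k v * of k p = if p.tgt = v then of k p else 0 := by
  rw [vertex, of_mul_of, pathMul]
  by_cases h : p.tgt = v
  · rw [if_pos h, dif_pos (show p.tgt = (QPath.nil v).src from h)]
    exact congrArg _ (QPath.nil_concat _ p h)
  · rw [if_neg h]
    exact dif_neg h

open Classical in
theorem of_mul_vertex (v : V) (p : QPath V) :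
    of k p * vertex k v = if p.src = v then of k p else 0 := by
  rw [vertex, of_mul_of, pathMul]
  by_cases h : p.src = v
  · rw [if_pos h, dif_pos (show (QPath.nil v).tgt = p.src from h.symm)]
    exact congrArg _ (QPath.concat_nil _ p h.symm)
  · rw [if_neg h]
    exact dif_neg fun h' => h h'.symm

open Classical in
theorem vertex_mul_vertex (v w : V) :
    vertex k v * vertex k w = if v = w then vertex k v else 0 := by
  rw [show vertex k w = of k (QPath.nil w) from rfl, vertex_mul_of]
  by_cases h : v = w
  · subst h; simp [QPath.nil, vertex]
  · rw [if_neg h, if_neg (fun h' => h h'.symm)]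

theorem vertex_mul_self (v : V) : vertex k v * vertex k v = vertex k v := by
  rw [vertex_mul_vertex, if_pos rfl]

open Classical in
theorem vertex_mul_arrow (v : V) (e : QArrow V) :
    vertex k v * arrow k e = if e.tgt = v then arrow k e else 0 :=
  vertex_mul_of v _

open Classical in
theorem arrow_mul_vertex (v : V) (e : QArrow V) :
    arrow k e * vertex k v = if e.src = v then arrow k e else 0 :=
  of_mul_vertex v _

theorem of_cons {a b c : V} (p : Quiver.Path a b) (e : b ⟶ c) :
    of k (⟨a, c, p.cons e⟩ : QPath V) = arrow k ⟨b, c, e⟩ * of k ⟨a, b, p⟩ := by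
  rw [arrow, of_mul_of, pathMul, dif_pos (show b = (QPath.arrow e).src from rfl)]
  rfl

theorem grade_mul_mem {m n : ℕ} {x y : PathAlgebra k V} (hx : x ∈ grade k V m)
    (hy : y ∈ grade k V n) : x * y ∈ grade k V (m + n) := by
  have h : grade k V m * grade k V n ≤ grade k V (m + n) := by
    rw [grade, grade, Submodule.span_mul_span, Submodule.span_le]
    rintro _ ⟨_, ⟨p, hp, rfl⟩, _, ⟨q, hq, rfl⟩, rfl⟩
    simp only [of_mul_of, pathMul]
    split_ifs with h
    · refine Submodule.subset_span ⟨_, ?_, rfl⟩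
      obtain ⟨a, b, p⟩ := p
      obtain ⟨c, d, q⟩ := q
      dsimp at h
      subst h
      simp only [QPath.length, QPath.concat, Quiver.Path.length_comp, Quiver.Path.cast_rfl_rfl]
        at hp hq ⊢
      omega
    · exact Submodule.zero_mem _
  exact h (Submodule.mul_mem_mul hx hy)

/-- Membership in a submodule, for the value of a linear map on the homogeneous part of degree `n`,
can be checked on paths, by induction on the length. -/
theorem forall_mem_grade {M : Type*} [AddCommGroup M] [Module k M] (f : PathAlgebra k V →ₗ[k] M)
    (T : ℕ → Submodule k M) (h0 : ∀ v, f (vertex k v) ∈ T 0)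
    (h1 : ∀ n e x, f x ∈ T n → f (arrow k e * x) ∈ T (n + 1)) (n : ℕ) (a : PathAlgebra k V)
    (ha : a ∈ grade k V n) : f a ∈ T n := by
  suffices h : grade k V n ≤ (T n).comap f from h ha
  rw [grade, Submodule.span_le]
  rintro _ ⟨⟨a, b, p⟩, rfl, rfl⟩
  change f _ ∈ T _
  clear ha
  induction p with
  | nil => exact h0 a
  | cons p e ih =>
    rw [of_cons]
    exact h1 _ _ _ ih

/-- Every path is a product of arrows and its source vertex, so an algebra map is known from these
generators. -/
theorem algHom_ext {B : Type*} [Semiring B] [Algebra k B] {φ ψ : PathAlgebra k V →ₐ[k] B}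
    (h0 : ∀ v, φ (vertex k v) = ψ (vertex k v)) (h1 : ∀ e, φ (arrow k e) = ψ (arrow k e)) :
    φ = ψ := by
  refine AlgHom.toLinearMap_injective ((basis k V).ext ?_)
  rintro ⟨a, b, p⟩
  rw [basis_apply]
  change φ _ = ψ _
  induction p with
  | nil => exact h0 a
  | cons p e ih => rw [of_cons, map_mul, map_mul, ih, h1]

/-- A subspace that contains the vertices and is stable under multiplication by arrows from the left
is everything. -/
theorem mem_of_generators (s : Set (PathAlgebra k V)) (hadd : ∀ x ∈ s, ∀ y ∈ s, x + y ∈ s)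
    (hsmul : ∀ c : k, ∀ x ∈ s, c • x ∈ s) (h0 : ∀ v, vertex k v ∈ s)
    (h1 : ∀ e, ∀ x ∈ s, arrow k e * x ∈ s) (hzero : (0 : PathAlgebra k V) ∈ s)
    (x : PathAlgebra k V) : x ∈ s := by
  let T : Submodule k (PathAlgebra k V) :=
    { carrier := s, add_mem' := fun hx hy => hadd _ hx _ hy, zero_mem' := hzero,
      smul_mem' := fun c _ hx => hsmul c _ hx }
  have h : x ∈ Submodule.span k (Set.range (basis k V)) := by
    rw [(basis k V).span_eq]; trivial
  refine (Submodule.span_le (p := T)).2 ?_ h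
  rintro _ ⟨⟨a, b, p⟩, rfl⟩
  rw [basis_apply]
  change _ ∈ s
  induction p with
  | nil => exact h0 a
  | cons p e ih =>
    rw [of_cons]
    exact h1 _ _ ih

/-- The images of the vertices and the arrows of a quiver under an algebra homomorphism from its
path algebra. -/
structure IsRep {B : Type*} [Semiring B] (f : V → B) (m : QArrow V → B) : Prop where
  mul_self : ∀ v, f v * f v = f v
  mul_of_ne : ∀ v w, v ≠ w → f v * f w = 0
  sum_eq_one : ∑ v, f v = 1
  tgt_mul : ∀ e, f e.tgt * m e = m e
  mul_src : ∀ e, m e * f e.src = m e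

section Lift

variable {B : Type*} [Semiring B] {f : V → B} {m : QArrow V → B}

theorem IsRep.tgt_mul_eval (h : IsRep f m) {a b : V} (p : Quiver.Path a b) :
    f b * evalPath f m p = evalPath f m p := by
  cases p with
  | nil => exact h.mul_self a
  | cons p e => rw [evalPath, ← mul_assoc, h.tgt_mul ⟨_, _, e⟩]

theorem IsRep.eval_mul_src (h : IsRep f m) {a b : V} (p : Quiver.Path a b) :
    evalPath f m p * f a = evalPath f m p := by
  induction p with
  | nil => exact h.mul_self a
  | cons p e ih => rw [evalPath, mul_assoc, ih]

theorem IsRep.eval_comp (h : IsRep f m) {a b c : V} (p : Quiver.Path a b) (q : Quiver.Path b c) :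
    evalPath f m (p.comp q) = evalPath f m q * evalPath f m p := by
  induction q with
  | nil => exact (h.tgt_mul_eval p).symm
  | cons q e ih => rw [Quiver.Path.comp_cons, evalPath, ih, evalPath, mul_assoc]

variable [Algebra k B]

/-- The linear map sending a path to the product of the images of its arrows. -/
def liftLinear (k : Type u) [CommRing k] [Algebra k B] (f : V → B) (m : QArrow V → B) :
    PathAlgebra k V →ₗ[k] B :=
  (basis k V).constr k fun p => evalPath f m p.path

theorem liftLinear_of (p : QPath V) : liftLinear k f m (of k p) = evalPath f m p.path := by
  rw [← basis_apply, liftLinear, Module.Basis.constr_basis]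

theorem IsRep.liftLinear_mul (h : IsRep f m) (x y : PathAlgebra k V) :
    liftLinear k f m (x * y) = liftLinear k f m x * liftLinear k f m y := by
  suffices H : (LinearMap.mul k (PathAlgebra k V)).compr₂ (liftLinear k f m) =
      (LinearMap.mul k B).compl₁₂ (liftLinear k f m) (liftLinear k f m) from
    LinearMap.congr_fun (LinearMap.congr_fun H x) y
  refine (basis k V).ext fun p => (basis k V).ext fun q => ?_
  simp only [basis_apply, LinearMap.compr₂_apply, LinearMap.compl₁₂_apply, LinearMap.mul_apply',
    of_mul_of, liftLinear_of, pathMul]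
  obtain ⟨a, b, p⟩ := p
  obtain ⟨c, d, q⟩ := q
  split_ifs with hpq
  · dsimp at hpq
    subst hpq
    rw [liftLinear_of, ← h.eval_comp]
    rfl
  · dsimp at hpq
    -- For non-composable paths, inserting the idempotents at the source of `p` and the target of
    -- `q` exposes an orthogonal product.
    rw [map_zero, ← h.tgt_mul_eval q, ← h.eval_mul_src p, mul_assoc, ← mul_assoc (f a),
      h.mul_of_ne a d (fun h => hpq h.symm), zero_mul, mul_zero]

/-- The universal property of the path algebra. -/
def IsRep.lift (k : Type u) [CommRing k] [Algebra k B] (h : IsRep f m) :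
    PathAlgebra k V →ₐ[k] B :=
  AlgHom.ofLinearMap (liftLinear k f m)
    (by
      rw [one_eq_sum, map_sum, ← h.sum_eq_one]
      exact Finset.sum_congr rfl fun v _ => liftLinear_of _)
    h.liftLinear_mul

theorem IsRep.lift_vertex (h : IsRep f m) (v : V) : h.lift k (vertex k v) = f v :=
  liftLinear_of _

theorem IsRep.lift_arrow (h : IsRep f m) (e : QArrow V) : h.lift k (arrow k e) = m e := by
  refine (liftLinear_of _).trans ?_
  -- A path of length one evaluates to `m e * f e.src`; the idempotent is absorbed.
  exact h.mul_src e

end Lift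

open Classical in
theorem isRep_char (v : V) :
    IsRep (fun w : V => if w = v then (1 : k) else 0) (fun _ : QArrow V => 0) where
  mul_self w := by by_cases h : w = v <;> simp [h]
  mul_of_ne a b hab := by
    by_cases h : a = v
    · subst h; simp [hab.symm]
    · simp [h]
  sum_eq_one := by simp
  tgt_mul _ := by simp
  mul_src _ := by simp

/-- The character of the path algebra given by a vertex. -/
def char (k : Type u) [CommRing k] {V : Type v} [Quiver.{w} V] [Fintype V] (v : V) :
    PathAlgebra k V →ₐ[k] k :=
  (isRep_char v).lift k

open Classical in
theorem char_vertex (v w : V) : char k v (vertex k w) = if w = v then 1 else 0 :=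
  (isRep_char v).lift_vertex w

theorem char_arrow (v : V) (e : QArrow V) : char k v (arrow k e) = 0 :=
  (isRep_char v).lift_arrow e

theorem char_grade (v : V) {n : ℕ} (hn : n ≠ 0) {x : PathAlgebra k V} (hx : x ∈ grade k V n) :
    char k v x = 0 := by
  -- Vanishing in positive degree is encoded by the family that is `⊤` in degree 0 and `⊥` above.
  have := forall_mem_grade (char k v).toLinearMap (fun n => if n = 0 then ⊤ else ⊥)
    (fun _ => by simp) (fun n e x _ => by simp [char_arrow]) n x hx
  simpa [hn] using this

theorem eq_sum_of_mem_grade_zero {x : PathAlgebra k V} (hx : x ∈ grade k V 0) :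
    x = ∑ v, char k v x • vertex k v := by
  rw [grade_zero_eq] at hx
  induction hx using Submodule.span_induction with
  | mem x h =>
    obtain ⟨v, rfl⟩ := h
    classical
    simp [char_vertex]
  | zero => simp
  | add x y _ _ hx hy =>
    simp only [map_add, add_smul, Finset.sum_add_distrib]
    rw [← hx, ← hy]
  | smul c x _ hx =>
    simp only [map_smul, smul_assoc, ← Finset.smul_sum]
    rw [← hx]

end Basic

/-- A character of the path algebra that vanishes on the arrows is given by a vertex. -/
theorem exists_eq_char {k : Type u} [Field k] {V : Type v} [Quiver.{w} V] [Fintype V]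
    (φ : PathAlgebra k V →ₐ[k] k) (h : ∀ e, φ (arrow k e) = 0) : ∃ v, φ = char k v := by
  -- The values on the vertices sum to φ(1) = 1, so one is nonzero. Idempotency makes that value 1,
  -- and orthogonality makes all the others 0.
  obtain ⟨v, hv⟩ : ∃ v, φ (vertex k v) ≠ 0 := by
    by_contra! H
    have h1 := map_one φ
    rw [one_eq_sum, map_sum, Finset.sum_eq_zero fun v _ => H v] at h1
    exact zero_ne_one h1
  refine ⟨v, algHom_ext (fun w => ?_) fun e => by rw [h, char_arrow]⟩
  rw [char_vertex]
  split_ifs with hw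
  · subst hw
    have := congrArg φ (vertex_mul_self (k := k) w)
    rw [map_mul] at this
    exact (mul_eq_right₀ hv).1 this
  · have := congrArg φ (vertex_mul_vertex (k := k) w v)
    rw [if_neg hw, map_mul, map_zero] at this
    exact (mul_eq_zero.1 this).resolve_right hv

theorem char_injective {k : Type u} [Field k] {V : Type v} [Quiver.{w} V] [Fintype V] :
    Function.Injective (char k : V → _) := by
  intro v w h
  have := congrArg (fun φ => φ (vertex k v)) h
  simp only [char_vertex, if_pos] at this
  by_contra hne
  rw [if_neg hne] at this
  exact one_ne_zero this

end PathAlgebra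

/-! ### Contractions of tensors and convolution of functionals -/

section Functionals

variable {k : Type u} [CommRing k]

/-- The contraction `x ⊗ y ↦ φ(x) y`. -/
def evalLeft {C : Type*} [Ring C] [Algebra k C] (φ : C →ₐ[k] k) (B : Type*) [Ring B]
    [Algebra k B] : C ⊗[k] B →ₐ[k] B :=
  (Algebra.TensorProduct.lid k B).toAlgHom.comp (Algebra.TensorProduct.map φ (AlgHom.id k B))

/-- The contraction `x ⊗ y ↦ φ(y) x`. -/
def evalRight {C : Type*} [Ring C] [Algebra k C] (φ : C →ₐ[k] k) (B : Type*) [Ring B]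
    [Algebra k B] : B ⊗[k] C →ₐ[k] B :=
  (Algebra.TensorProduct.rid k k B).toAlgHom.comp (Algebra.TensorProduct.map (AlgHom.id k B) φ)

/-- The contraction `x ⊗ y ↦ φ(x) y` for a linear functional `φ`. -/
def evalLinear {C : Type*} [Ring C] [Algebra k C] (φ : C →ₗ[k] k) (B : Type*) [Ring B]
    [Algebra k B] : C ⊗[k] B →ₗ[k] B :=
  TensorProduct.lid k B ∘ₗ φ.rTensor B

/-- The character `x ⊗ y ↦ φ(x) ψ(y)`. -/
def charProd {C D : Type*} [Ring C] [Algebra k C] [Ring D] [Algebra k D] (φ : C →ₐ[k] k)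
    (ψ : D →ₐ[k] k) : C ⊗[k] D →ₐ[k] k :=
  Algebra.TensorProduct.lift φ ψ fun _ _ => Commute.all _ _

section

variable {C D : Type*} [Ring C] [Algebra k C] [Ring D] [Algebra k D]

@[simp] theorem evalLeft_tmul (φ : C →ₐ[k] k) (x : C) (y : D) :
    evalLeft φ D (x ⊗ₜ y) = φ x • y := by
  simp [evalLeft]

@[simp] theorem evalRight_tmul (φ : C →ₐ[k] k) (x : C) (y : D) :
    evalRight φ D (y ⊗ₜ x) = φ x • y := by
  simp [evalRight]

@[simp] theorem evalLinear_tmul (φ : C →ₗ[k] k) (x : C) (y : D) :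
    evalLinear φ D (x ⊗ₜ y) = φ x • y := by
  simp [evalLinear]

@[simp] theorem charProd_tmul (φ : C →ₐ[k] k) (ψ : D →ₐ[k] k) (x : C) (y : D) :
    charProd φ ψ (x ⊗ₜ y) = φ x * ψ y := by
  simp [charProd]

theorem evalLeft_eq_evalLinear (φ : C →ₐ[k] k) (t : C ⊗[k] D) :
    evalLeft φ D t = evalLinear φ.toLinearMap D t := by
  induction t with
  | zero => simp
  | tmul x y => simp
  | add x y hx hy => simp [hx, hy]

theorem evalLeft_comm (φ : C →ₐ[k] k) (t : D ⊗[k] C) :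
    evalLeft φ D (Algebra.TensorProduct.comm k D C t) = evalRight φ D t := by
  induction t with
  | zero => simp
  | tmul x y => simp
  | add x y hx hy => simp only [map_add, hx, hy]

theorem evalRight_comm (φ : C →ₐ[k] k) (t : C ⊗[k] D) :
    evalRight φ D (Algebra.TensorProduct.comm k C D t) = evalLeft φ D t := by
  induction t with
  | zero => simp
  | tmul x y => simp
  | add x y hx hy => simp only [map_add, hx, hy]

theorem map_evalLeft (φ : C →ₐ[k] k) (ψ : D →ₐ[k] k) (t : C ⊗[k] D) :
    ψ (evalLeft φ D t) = charProd φ ψ t := by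
  induction t with
  | zero => simp
  | tmul x y => simp
  | add x y hx hy => simp only [map_add, hx, hy]

theorem charProd_comm (φ : C →ₐ[k] k) (ψ : D →ₐ[k] k) (t : C ⊗[k] D) :
    charProd ψ φ (Algebra.TensorProduct.comm k C D t) = charProd φ ψ t := by
  induction t with
  | zero => simp
  | tmul x y => simp [mul_comm]
  | add x y hx hy => simp only [map_add, hx, hy]

end

variable {A : Type v} [Ring A] [Algebra k A]

theorem comul_evalLinear (H : HopfStructure k A) (φ : A →ₗ[k] k) (t : A ⊗[k] A) :
    H.comul (evalLinear φ A t) =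
      evalLinear φ (A ⊗[k] A) (Algebra.TensorProduct.map (AlgHom.id k A) H.comul t) := by
  induction t with
  | zero => simp
  | tmul x y => simp
  | add x y hx hy => simp only [map_add, hx, hy]

/-- The product of linear functionals on a Hopf algebra. -/
def HopfStructure.conv (H : HopfStructure k A) (φ ψ : A →ₗ[k] k) : A →ₗ[k] k :=
  LinearMap.mul' k k ∘ₗ TensorProduct.map φ ψ ∘ₗ H.comul.toLinearMap

/-- The translation `a ↦ ∑ φ(a₍₁₎) a₍₂₎`. -/
def HopfStructure.translate (H : HopfStructure k A) (φ : A →ₗ[k] k) : A →ₗ[k] A :=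
  evalLinear φ A ∘ₗ H.comul.toLinearMap

/-- This is coassociativity, contracted with φ in the first leg and ψ in the second. Note the order:
the inner translation is the left factor of the convolution. -/
theorem HopfStructure.translate_translate (H : HopfStructure k A) (φ ψ : A →ₗ[k] k) (a : A) :
    H.translate ψ (H.translate φ a) = H.translate (H.conv φ ψ) a := by
  have h := congrArg (fun F => F a) H.coassoc
  simp only [AlgHom.comp_apply] at h
  simp only [HopfStructure.translate, LinearMap.comp_apply, AlgHom.toLinearMap_apply,
    comul_evalLinear]
  rw [← h]
  have h2 : ∀ t : A ⊗[k] A ⊗[k] A, evalLinear ψ A (evalLinear φ (A ⊗[k] A)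
      (Algebra.TensorProduct.assoc k k k A A A t)) =
      evalLinear (LinearMap.mul' k k ∘ₗ TensorProduct.map φ ψ) A t := by
    intro t
    induction t with
    | zero => simp
    | add x y hx hy => simp only [map_add, hx, hy]
    | tmul x z =>
      induction x with
      | zero => simp
      | add x y hx hy => simp only [map_add, hx, hy, TensorProduct.add_tmul]
      | tmul x y => simp [smul_smul]
  refine (h2 _).trans ?_
  generalize H.comul a = t
  induction t with
  | zero => simp
  | add x y hx hy => simp only [map_add, hx, hy]
  | tmul x y => simp [HopfStructure.conv]

theorem HopfStructure.translate_counit (H : HopfStructure k A) (a : A) :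
    H.translate H.counit.toLinearMap a = a := by
  have h := congrArg (fun F => (Algebra.TensorProduct.lid k A) (F a)) H.rTensor_counit_comp_comul
  simp only [AlgHom.comp_apply] at h
  rw [HopfStructure.translate, LinearMap.comp_apply, ← evalLeft_eq_evalLinear]
  refine h.trans ?_
  simp

theorem HopfStructure.conv_eq (H : HopfStructure k A) (φ ψ : A →ₗ[k] k) :
    H.conv φ ψ = ψ ∘ₗ H.translate φ := by
  ext a
  simp only [HopfStructure.conv, HopfStructure.translate, LinearMap.comp_apply]
  generalize H.comul.toLinearMap a = t
  induction t with
  | zero => simp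
  | add x y hx hy => simp only [map_add, hx, hy]
  | tmul x y => simp

theorem HopfStructure.conv_assoc (H : HopfStructure k A) (φ ψ θ : A →ₗ[k] k) :
    H.conv (H.conv φ ψ) θ = H.conv φ (H.conv ψ θ) := by
  ext a
  simp only [H.conv_eq _ θ, LinearMap.comp_apply, ← H.translate_translate]
  rw [H.conv_eq φ]
  simp

theorem HopfStructure.counit_conv (H : HopfStructure k A) (φ : A →ₗ[k] k) :
    H.conv H.counit.toLinearMap φ = φ := by
  ext a
  rw [H.conv_eq, LinearMap.comp_apply, H.translate_counit]

/-- Applying the algebra map φ to the antipode axiom exhibits φ ∘ S as a left convolution inverse of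
φ. It is kept as a linear functional, since S is not assumed to be antimultiplicative. -/
theorem HopfStructure.antipode_conv (H : HopfStructure k A) (φ : A →ₐ[k] k) :
    H.conv (φ.toLinearMap ∘ₗ H.antipode) φ.toLinearMap = H.counit.toLinearMap := by
  ext a
  have h := congrArg φ (LinearMap.congr_fun H.mul_antipode_rTensor_comul a)
  simp only [LinearMap.comp_apply, AlgHom.toLinearMap_apply, Algebra.linearMap_apply,
    AlgHom.commutes, Algebra.algebraMap_self, RingHom.id_apply] at h
  rw [AlgHom.toLinearMap_apply, ← h]
  simp only [HopfStructure.conv, LinearMap.comp_apply, AlgHom.toLinearMap_apply]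
  generalize H.comul a = t
  induction t with
  | zero => simp
  | add x y hx hy => simp only [map_add, hx, hy]
  | tmul x y => simp

/-- The product of characters of a Hopf algebra. -/
def HopfStructure.convChar (H : HopfStructure k A) (φ ψ : A →ₐ[k] k) : A →ₐ[k] k :=
  (charProd φ ψ).comp H.comul

theorem HopfStructure.convChar_toLinearMap (H : HopfStructure k A) (φ ψ : A →ₐ[k] k) :
    (H.convChar φ ψ).toLinearMap = H.conv φ.toLinearMap ψ.toLinearMap := by
  ext a
  simp only [HopfStructure.convChar, HopfStructure.conv, LinearMap.comp_apply,
    AlgHom.toLinearMap_apply, AlgHom.comp_apply]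
  generalize H.comul a = t
  induction t with
  | zero => simp
  | add x y hx hy => simp only [map_add, hx, hy]
  | tmul x y => simp

theorem tensorSub_induction {p q : Submodule k A} {P : A ⊗[k] A → Prop}
    (h0 : P 0) (hadd : ∀ x y, P x → P y → P (x + y))
    (ht : ∀ x ∈ p, ∀ y ∈ q, P (x ⊗ₜ y)) {t : A ⊗[k] A} (h : t ∈ tensorSub p q) : P t := by
  obtain ⟨s, rfl⟩ := h
  induction s with
  | zero => simpa using h0
  | add x y hx hy => rw [map_add]; exact hadd _ _ hx hy
  | tmul x y => exact ht _ x.2 _ y.2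

theorem iSup_tensorSub_induction {𝒜 : ℕ → Submodule k A} {n : ℕ} {P : A ⊗[k] A → Prop}
    (h0 : P 0) (hadd : ∀ x y, P x → P y → P (x + y))
    (ht : ∀ i j, i + j = n → ∀ x ∈ 𝒜 i, ∀ y ∈ 𝒜 j, P (x ⊗ₜ y)) {t : A ⊗[k] A}
    (h : t ∈ ⨆ (i : ℕ) (j : ℕ) (_ : i + j = n), tensorSub (𝒜 i) (𝒜 j)) : P t := by
  induction h using Submodule.iSup_induction' with
  | zero => exact h0
  | add x y _ _ hx hy => exact hadd _ _ hx hy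
  | mem i x hx =>
    induction hx using Submodule.iSup_induction' with
    | zero => exact h0
    | add x y _ _ hx hy => exact hadd _ _ hx hy
    | mem j x hx =>
      induction hx using Submodule.iSup_induction' with
      | zero => exact h0
      | add x y _ _ hx hy => exact hadd _ _ hx hy
      | mem hij x hx => exact tensorSub_induction h0 hadd (ht i j hij) hx

theorem tmul_mem_iSup {𝒜 : ℕ → Submodule k A} {n : ℕ} (i j : ℕ) (hij : i + j = n) {x y : A}
    (hx : x ∈ 𝒜 i) (hy : y ∈ 𝒜 j) :
    x ⊗ₜ[k] y ∈ ⨆ (i : ℕ) (j : ℕ) (_ : i + j = n), tensorSub (𝒜 i) (𝒜 j) :=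
  Submodule.mem_iSup_of_mem i <| Submodule.mem_iSup_of_mem j <| Submodule.mem_iSup_of_mem hij
    ⟨⟨x, hx⟩ ⊗ₜ ⟨y, hy⟩, by simp⟩

end Functionals

/-! ### Translations by vertices -/

namespace PathAlgebra

section Translation

variable {k : Type u} [CommRing k] {V : Type v} [Quiver.{w} V] [Fintype V]

/-- The product of the characters given by the vertices is given by the product of a group
structure on the vertices, and the counit by the unit of the group. -/
structure IsCharGroup [CommGroup V] (H : HopfStructure k (PathAlgebra k V)) : Prop where
  convChar_char : ∀ v w : V, H.convChar (char k v) (char k w) = char k (v * w)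
  counit_eq : H.counit = char k 1

/-- The translation of the path algebra given by a vertex. -/
def shift (H : HopfStructure k (PathAlgebra k V)) (g : V) : PathAlgebra k V →ₐ[k] PathAlgebra k V :=
  (evalLeft (char k g) _).comp H.comul

theorem shift_apply (H : HopfStructure k (PathAlgebra k V)) (g : V) (a : PathAlgebra k V) :
    shift H g a = H.translate (char k g).toLinearMap a :=
  evalLeft_eq_evalLinear _ _

theorem shift_mem_grade {H : HopfStructure k (PathAlgebra k V)} (hH : H.IsGraded (grade k V))
    (g : V) {n : ℕ} {a : PathAlgebra k V} (ha : a ∈ grade k V n) : shift H g a ∈ grade k V n := by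
  rw [shift, AlgHom.comp_apply]
  refine iSup_tensorSub_induction (P := fun t => evalLeft (char k g) _ t ∈ grade k V n) (by simp)
    (fun x y hx hy => by rw [map_add]; exact add_mem hx hy) ?_ (hH.comul_mem n a ha)
  intro i j hij x hx y hy
  rw [evalLeft_tmul]
  by_cases hi : i = 0
  · subst hi
    rw [zero_add] at hij
    subst hij
    exact Submodule.smul_mem _ _ hy
  · rw [char_grade _ hi hx, zero_smul]
    exact zero_mem _

/-- The comultiplication of an element of degree one. -/
theorem comul_of_mem_grade_one {H : HopfStructure k (PathAlgebra k V)}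
    (hH : H.IsGraded (grade k V)) {a : PathAlgebra k V} (ha : a ∈ grade k V 1) :
    H.comul a = ∑ g, (vertex k g ⊗ₜ shift H g a +
      evalRight (char k g) _ (H.comul a) ⊗ₜ vertex k g) := by
  simp only [shift, AlgHom.comp_apply]
  refine iSup_tensorSub_induction (P := fun t => t = ∑ g, (vertex k g ⊗ₜ evalLeft (char k g) _ t +
      evalRight (char k g) _ t ⊗ₜ vertex k g)) (by simp)
    (fun x y hx hy => ?_) ?_ (hH.comul_mem 1 a ha)
  · simp only [map_add, TensorProduct.tmul_add, TensorProduct.add_tmul]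
    conv_lhs => rw [hx, hy]
    simp only [← Finset.sum_add_distrib]
    exact Finset.sum_congr rfl fun g _ => by abel
  · intro i j hij x hx y hy
    simp only [evalLeft_tmul, evalRight_tmul]
    -- In total degree one, exactly one leg has degree zero. It expands in the vertices, while
    -- characters kill the leg of degree one, so only one of the two sums survives.
    obtain ⟨rfl, rfl⟩ | ⟨rfl, rfl⟩ : (i = 0 ∧ j = 1) ∨ (i = 1 ∧ j = 0) := by omega
    · simp only [char_grade _ one_ne_zero hy, zero_smul, TensorProduct.zero_tmul, add_zero]
      conv_lhs => rw [eq_sum_of_mem_grade_zero hx, TensorProduct.sum_tmul]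
      exact Finset.sum_congr rfl fun g _ => TensorProduct.smul_tmul _ _ _
    · simp only [char_grade _ one_ne_zero hx, zero_smul, TensorProduct.tmul_zero, zero_add]
      conv_lhs => rw [eq_sum_of_mem_grade_zero hy, TensorProduct.tmul_sum]
      exact Finset.sum_congr rfl fun g _ => (TensorProduct.smul_tmul _ _ _).symm

variable [CommGroup V] {H : HopfStructure k (PathAlgebra k V)}

/-- Composition of translations reverses the order of convolution; commutativity of the vertex group
absorbs this. -/
theorem IsCharGroup.shift_shift (hc : IsCharGroup H) (g h : V) (a : PathAlgebra k V) :
    shift H g (shift H h a) = shift H (g * h) a := by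
  rw [shift_apply, shift_apply, shift_apply, H.translate_translate, ← H.convChar_toLinearMap,
    hc.convChar_char, mul_comm]

theorem IsCharGroup.shift_one (hc : IsCharGroup H) (a : PathAlgebra k V) : shift H 1 a = a := by
  rw [shift_apply, ← hc.counit_eq, H.translate_counit]

theorem IsCharGroup.shift_inv_shift (hc : IsCharGroup H) (g : V) (a : PathAlgebra k V) :
    shift H g⁻¹ (shift H g a) = a := by
  rw [hc.shift_shift, inv_mul_cancel, hc.shift_one]

theorem IsCharGroup.shift_injective (hc : IsCharGroup H) (g : V) :
    Function.Injective (shift H g) :=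
  Function.LeftInverse.injective (hc.shift_inv_shift g)

theorem IsCharGroup.char_shift (hc : IsCharGroup H) (g h : V) (a : PathAlgebra k V) :
    char k h (shift H g a) = char k (g * h) a := by
  rw [shift, AlgHom.comp_apply, map_evalLeft, ← hc.convChar_char]
  rfl

/-- The shift preserves degree zero, where an element is determined by its character values, and
`char_shift` supplies these. -/
theorem IsCharGroup.shift_vertex (hc : IsCharGroup H) (hH : H.IsGraded (grade k V)) (g v : V) :
    shift H g (vertex k v) = vertex k (g⁻¹ * v) := by
  classical
  rw [eq_sum_of_mem_grade_zero (shift_mem_grade hH g (vertex_mem_grade v))]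
  simp only [hc.char_shift, char_vertex, ite_smul, one_smul, zero_smul, ← inv_mul_eq_iff_eq_mul]
  simp

end Translation

/-! ### Arrow spaces and the Hopf quiver condition -/

section Arrows

variable {k : Type u} [Field k] {V : Type v} [Quiver.{w} V]

/-- The span of the arrows from `a` to `b`. -/
def block (k : Type u) [Field k] {V : Type v} [Quiver.{w} V] (a b : V) :
    Submodule k (PathAlgebra k V) :=
  Submodule.span k (Set.range fun e : a ⟶ b => arrow k ⟨a, b, e⟩)

theorem block_le_grade (a b : V) : block k a b ≤ grade k V 1 :=
  Submodule.span_le.2 <| by rintro _ ⟨e, rfl⟩; exact arrow_mem_grade _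

theorem finrank_block (a b : V) [Finite (a ⟶ b)] :
    Module.finrank k (block k a b) = Nat.card (a ⟶ b) := by
  have := Fintype.ofFinite (a ⟶ b)
  rw [block, finrank_span_eq_card, Nat.card_eq_fintype_card]
  refine (linearIndependent_arrow (k := k)).comp (fun e : a ⟶ b => QArrow.mk a b e) ?_
  intro e e' h
  simpa using h

instance (a b : V) [Finite (a ⟶ b)] : FiniteDimensional k (block k a b) :=
  FiniteDimensional.span_of_finite k (Set.finite_range _)

variable [Fintype V]

/-- Together with the next lemma this describes the arrow space as e_b A₁ e_a, a form that graded
algebra maps permuting the vertices visibly respect. -/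
theorem vertex_mul_mul_vertex_mem_block (a b : V) {x : PathAlgebra k V} (hx : x ∈ grade k V 1) :
    vertex k b * x * vertex k a ∈ block k a b := by
  rw [grade_one_eq] at hx
  induction hx using Submodule.span_induction with
  | zero => simp
  | add x y _ _ hx hy => rw [mul_add, add_mul]; exact add_mem hx hy
  | smul c x _ hx =>
    rw [mul_smul_comm, smul_mul_assoc]
    exact Submodule.smul_mem _ _ hx
  | mem x h =>
    obtain ⟨⟨s, t, e⟩, rfl⟩ := h
    rw [vertex_mul_arrow]
    split_ifs with h
    · rw [arrow_mul_vertex]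
      split_ifs with h'
      · dsimp at h h'
        subst h h'
        exact Submodule.subset_span ⟨e, rfl⟩
      · exact zero_mem _
    · simp

theorem vertex_mul_mul_vertex_of_mem_block {a b : V} {x : PathAlgebra k V} (hx : x ∈ block k a b) :
    vertex k b * x * vertex k a = x := by
  rw [block] at hx
  induction hx using Submodule.span_induction with
  | zero => simp
  | add x y _ _ hx hy => rw [mul_add, add_mul, hx, hy]
  | smul c x _ hx => rw [mul_smul_comm, smul_mul_assoc, hx]
  | mem x h =>
    obtain ⟨e, rfl⟩ := h
    rw [vertex_mul_arrow, if_pos rfl, arrow_mul_vertex, if_pos rfl]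

variable [CommGroup V] {H : HopfStructure k (PathAlgebra k V)}

theorem IsCharGroup.shift_mem_block (hc : IsCharGroup H) (hH : H.IsGraded (grade k V)) (g : V)
    {a b : V} {x : PathAlgebra k V} (hx : x ∈ block k a b) :
    shift H g x ∈ block k (g⁻¹ * a) (g⁻¹ * b) := by
  rw [← vertex_mul_mul_vertex_of_mem_block hx, map_mul, map_mul, hc.shift_vertex hH,
    hc.shift_vertex hH]
  exact vertex_mul_mul_vertex_mem_block _ _ (shift_mem_grade hH g (block_le_grade a b hx))

/-- A shift sends arrows to linear combinations of arrows, not to arrows, so the count goes through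
dimensions of arrow spaces. -/
theorem IsCharGroup.card_le (hc : IsCharGroup H) (hH : H.IsGraded (grade k V))
    [∀ a b : V, Finite (a ⟶ b)] (g a b : V) :
    Nat.card (a ⟶ b) ≤ Nat.card (g⁻¹ * a ⟶ g⁻¹ * b) := by
  rw [← finrank_block (k := k), ← finrank_block (k := k)]
  exact LinearMap.finrank_le_finrank_of_injective
    (f := (shift H g).toLinearMap.restrict fun x hx => hc.shift_mem_block hH g hx)
    fun x y hxy => Subtype.ext (hc.shift_injective g (congrArg Subtype.val hxy))

theorem IsCharGroup.card_eq (hc : IsCharGroup H) (hH : H.IsGraded (grade k V))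
    [∀ a b : V, Finite (a ⟶ b)] (g a b : V) :
    Nat.card (a ⟶ b) = Nat.card (g⁻¹ * a ⟶ g⁻¹ * b) := by
  refine le_antisymm (hc.card_le hH g a b) ?_
  have := hc.card_le hH g⁻¹ (g⁻¹ * a) (g⁻¹ * b)
  rwa [inv_inv, mul_inv_cancel_left, mul_inv_cancel_left] at this

/-- The path algebra of a quiver is graded Hopf with an abelian group of vertices only if the quiver
is the Hopf quiver of this group. -/
theorem IsCharGroup.exists_quiverIso (hc : IsCharGroup H) (hH : H.IsGraded (grade k V))
    [∀ a b : V, Finite (a ⟶ b)] :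
    ∃ S : ConjClasses V → ℕ, Nonempty (QuiverIso V (HopfQuiver V S)) := by
  -- Classes of an abelian group are singletons, so S at C = {c} can be taken to be the number of
  -- arrows from 1 to c. Translation by a moves the arrows a → b to arrows 1 → a⁻¹b.
  refine ⟨fun C => Nat.card ((1 : V) ⟶ ConjClasses.mkEquiv.symm C),
    ⟨⟨Equiv.refl V, fun a b => ?_⟩⟩⟩
  refine (Finite.equivFin (a ⟶ b)).trans (finCongr ?_)
  rw [hc.card_eq hH a]
  have h : ConjClasses.mkEquiv.symm (ConjClasses.mk (b * a⁻¹)) = a⁻¹ * b := by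
    rw [Equiv.symm_apply_eq, mul_comm]
    rfl
  rw [inv_mul_cancel]
  exact congrArg (fun c : V => Nat.card ((1 : V) ⟶ c)) h.symm

end Arrows

/-! ### The abelian group of vertices -/

section CharGroup

variable {k : Type u} [Field k] {V : Type v} [Quiver.{w} V] [Fintype V]
  {H : HopfStructure k (PathAlgebra k V)}

/-- Each term of Δ(e) has a leg of positive degree, which one of the two characters kills. Hence the
product is again given by a vertex. -/
theorem convChar_char_arrow (hH : H.IsGraded (grade k V)) (v w : V) (e : QArrow V) :
    H.convChar (char k v) (char k w) (arrow k e) = 0 := by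
  rw [HopfStructure.convChar, AlgHom.comp_apply]
  refine iSup_tensorSub_induction (P := fun t => charProd (char k v) (char k w) t = 0) (by simp)
    (fun x y hx hy => by rw [map_add, hx, hy, add_zero]) ?_ (hH.comul_mem 1 _ (arrow_mem_grade e))
  intro i j hij x hx y hy
  rw [charProd_tmul]
  by_cases hi : i = 0
  · rw [char_grade w (by omega) hy, mul_zero]
  · rw [char_grade v hi hx, zero_mul]

/-- The group of vertices of a graded Hopf structure whose characters commute. -/
theorem exists_isCharGroup (hH : H.IsGraded (grade k V))
    (hcomm : ∀ v w : V, H.convChar (char k v) (char k w) = H.convChar (char k w) (char k v)) :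
    ∃ _ : CommGroup V, IsCharGroup H := by
  choose m hm using fun v w : V =>
    exists_eq_char (H.convChar (char k v) (char k w)) (convChar_char_arrow hH v w)
  obtain ⟨u, hu⟩ := exists_eq_char H.counit
    fun e => hH.counit_eq_zero 1 one_ne_zero _ (arrow_mem_grade e)
  have hlin : Function.Injective fun v : V => (char k v).toLinearMap :=
    AlgHom.toLinearMap_injective.comp char_injective
  have hconv (v w : V) : (char k (m v w)).toLinearMap =
      H.conv (char k v).toLinearMap (char k w).toLinearMap := by
    rw [← hm, H.convChar_toLinearMap]
  have hmc (v w : V) : m v w = m w v := char_injective (by rw [← hm, ← hm, hcomm])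
  have hassoc (a b c : V) : m (m a b) c = m a (m b c) :=
    hlin (by simp only [hconv, H.conv_assoc])
  have hone (a : V) : m u a = a := hlin (by simp only [hconv, ← hu, H.counit_conv])
  -- Convolution with `char k v` ∘ S cancels v on the left. That functional is not known to come
  -- from a vertex; the inverse in `V` is obtained from injectivity and finiteness.
  have hinj (v : V) : Function.Injective (m v) := by
    intro w w' h
    refine hlin ?_
    have h' := congrArg (fun x => H.conv ((char k v).toLinearMap ∘ₗ H.antipode)
      (char k x).toLinearMap) h
    simpa only [hconv, ← H.conv_assoc, H.antipode_conv, H.counit_conv] using h'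
  choose i hi using fun v : V => (Finite.surjective_of_injective (hinj v)) u
  let _ : Mul V := ⟨m⟩
  let _ : Inv V := ⟨i⟩
  let _ : One V := ⟨u⟩
  let gr : Group V := Group.ofLeftAxioms hassoc hone fun a => (hmc _ _).trans (hi a)
  let cg : CommGroup V := { gr with mul_comm := hmc }
  exact ⟨cg, ⟨hm, hu⟩⟩

end CharGroup

/-- The vertices of a quiver whose path algebra is graded quasitriangular form an abelian group. -/
theorem exists_commGroup_isCharGroup {k : Type u} [Field k] {V : Type v} [Quiver.{w} V] [Fintype V]
    (X : GradedQuasitriangular k V) : ∃ _ : CommGroup V, IsCharGroup X.hopf := by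
  refine exists_isCharGroup X.isGraded fun v w => AlgHom.ext fun a => ?_
  -- The pairing is an algebra map to a commutative ring, so conjugation by R becomes trivial and
  -- only the flip remains.
  have h := congrArg (charProd (char k w) (char k v)) (X.isUniversalRMatrix.comul_op a)
  rw [charProd_comm, map_mul, map_mul, mul_right_comm, ← map_mul, Units.mul_inv, map_one,
    one_mul] at h
  exact h

end PathAlgebra

/-! ### The comultiplication attached to a bicharacter -/

/-- An action of an abelian group structure on the vertices of a quiver on its arrows, compatible
with translations of the vertices. -/
class ArrowTranslation (V : Type v) [Quiver.{w} V] [CommGroup V] extends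
    MulAction V (QArrow V) where
  smul_src : ∀ (g : V) (e : QArrow V), (g • e).src = g * e.src
  smul_tgt : ∀ (g : V) (e : QArrow V), (g • e).tgt = g * e.tgt

namespace PathAlgebra

/-- Reindexing of an iterated sum over products in a group. -/
theorem sum_sum_inv_mul {V : Type*} [Fintype V] [CommGroup V] {M : Type*} [AddCommMonoid M]
    (F : V → V → V → M) :
    ∑ g, ∑ x, F x (x⁻¹ * g) g = ∑ x, ∑ y, F x y (x * y) := by
  rw [Finset.sum_comm]
  refine Finset.sum_congr rfl fun x _ => ?_
  rw [← Equiv.sum_comp (Equiv.mulLeft x)]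
  simp

section Degree

variable {V : Type v} [Quiver.{w} V] [CommGroup V]

/-- The quotient of the target by the source of an arrow. -/
def arrowDegree (e : QArrow V) : V := e.tgt * e.src⁻¹

theorem arrowDegree_smul [ArrowTranslation V] (g : V) (e : QArrow V) :
    arrowDegree (g • e) = arrowDegree e := by
  simp only [arrowDegree, ArrowTranslation.smul_src, ArrowTranslation.smul_tgt, mul_inv_rev]
  rw [mul_comm g, mul_assoc, mul_comm e.src⁻¹, mul_inv_cancel_left]

end Degree

section VertexTensors

variable {k : Type u} [CommRing k] {V : Type v} [Quiver.{w} V] [Fintype V]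

open Classical in
theorem vertex_mul_eq_ite {s : V} {x : PathAlgebra k V} (hx : vertex k s * x = x) (a : V) :
    vertex k a * x = if a = s then x else 0 := by
  conv_lhs => rw [← hx, ← mul_assoc, vertex_mul_vertex]
  split_ifs with h
  · subst h; exact hx
  · exact zero_mul _

open Classical in
theorem mul_vertex_eq_ite {s : V} {x : PathAlgebra k V} (hx : x * vertex k s = x) (a : V) :
    x * vertex k a = if a = s then x else 0 := by
  conv_lhs => rw [← hx, mul_assoc, vertex_mul_vertex]
  by_cases h : s = a
  · subst h; simpa using hx
  · simp [h, Ne.symm h]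

theorem tgt_mul_arrow (e : QArrow V) : vertex k e.tgt * arrow k e = arrow k e := by
  rw [vertex_mul_arrow, if_pos rfl]

theorem arrow_mul_src (e : QArrow V) : arrow k e * vertex k e.src = arrow k e := by
  rw [arrow_mul_vertex, if_pos rfl]

/-- The element of the tensor square of the span of the vertices given by a matrix. -/
def diagonalTensor (f : V → V → k) : PathAlgebra k V ⊗[k] PathAlgebra k V :=
  ∑ g : V, ∑ h : V, f g h • (vertex k g ⊗ₜ vertex k h)

/-- Diagonal tensors act by scalars on tensors with fixed targets (below: fixed sources), so
identities involving R reduce to identities between values of χ. -/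
theorem diagonalTensor_mul_tmul (f : V → V → k) {s t : V} {x y : PathAlgebra k V}
    (hx : vertex k s * x = x) (hy : vertex k t * y = y) :
    diagonalTensor f * (x ⊗ₜ y) = f s t • (x ⊗ₜ y) := by
  classical
  simp [diagonalTensor, Finset.sum_mul, smul_mul_assoc, Algebra.TensorProduct.tmul_mul_tmul,
    vertex_mul_eq_ite hx,
    vertex_mul_eq_ite hy, TensorProduct.ite_tmul, TensorProduct.tmul_ite]

theorem tmul_mul_diagonalTensor (f : V → V → k) {s t : V} {x y : PathAlgebra k V}
    (hx : x * vertex k s = x) (hy : y * vertex k t = y) :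
    (x ⊗ₜ y) * diagonalTensor f = f s t • (x ⊗ₜ y) := by
  classical
  simp [diagonalTensor, Finset.mul_sum, mul_smul_comm, Algebra.TensorProduct.tmul_mul_tmul,
    mul_vertex_eq_ite hx,
    mul_vertex_eq_ite hy, TensorProduct.ite_tmul, TensorProduct.tmul_ite]

theorem diagonalTensor_mul (f f' : V → V → k) :
    diagonalTensor f * diagonalTensor f' = diagonalTensor fun g h => f g h * f' g h := by
  conv_lhs => rw [diagonalTensor.eq_1 f']
  simp only [Finset.mul_sum, mul_smul_comm,
    diagonalTensor_mul_tmul f (vertex_mul_self _) (vertex_mul_self _)]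
  simp only [diagonalTensor, smul_smul, mul_comm]

theorem diagonalTensor_one : diagonalTensor (fun _ _ : V => (1 : k)) = 1 := by
  simp only [diagonalTensor, one_smul, ← TensorProduct.tmul_sum, ← TensorProduct.sum_tmul,
    ← one_eq_sum]
  rfl

theorem leg13_mul_tmul (f : V → V → k) (x y z : V) :
    leg13 k (PathAlgebra k V) (diagonalTensor f) * (vertex k x ⊗ₜ (vertex k y ⊗ₜ vertex k z)) =
      f x z • (vertex k x ⊗ₜ (vertex k y ⊗ₜ vertex k z)) := by
  classical
  simp [leg13, diagonalTensor, Finset.sum_mul, smul_mul_assoc,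
    vertex_mul_eq_ite (vertex_mul_self _),
    TensorProduct.ite_tmul, TensorProduct.tmul_ite]

theorem leg23_diagonalTensor (f : V → V → k) :
    leg23 k (PathAlgebra k V) (diagonalTensor f) =
      ∑ x : V, ∑ y : V, ∑ z : V, f y z • (vertex k x ⊗ₜ (vertex k y ⊗ₜ vertex k z)) := by
  simp only [leg23, diagonalTensor, map_sum, map_smul,
    Algebra.TensorProduct.includeRight_apply, one_eq_sum, TensorProduct.sum_tmul, Finset.smul_sum]
  conv_rhs => rw [Finset.sum_comm]
  exact Finset.sum_congr rfl fun y _ => Finset.sum_comm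

theorem leg12_diagonalTensor (f : V → V → k) :
    leg12 k (PathAlgebra k V) (diagonalTensor f) =
      ∑ x : V, ∑ y : V, ∑ z : V, f x y • (vertex k x ⊗ₜ (vertex k y ⊗ₜ vertex k z)) := by
  simp [leg12, diagonalTensor, one_eq_sum, TensorProduct.tmul_sum, Finset.smul_sum]

end VertexTensors

section Comul

variable {k : Type u} [CommRing k] {V : Type v} [Quiver.{w} V] [Fintype V] [CommGroup V]

/-- The comultiplication of a vertex. -/
def comulVertex (k : Type u) [CommRing k] {V : Type v} [Quiver.{w} V] [Fintype V] [CommGroup V]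
    (v : V) : PathAlgebra k V ⊗[k] PathAlgebra k V :=
  ∑ x : V, vertex k x ⊗ₜ vertex k (x⁻¹ * v)

open Classical in
-- Left multiplication by `comulVertex k v` projects onto the tensors whose two targets multiply to
-- v. On the right the same holds for sources.
theorem comulVertex_mul_tmul (v : V) {s t : V} {x y : PathAlgebra k V}
    (hx : vertex k s * x = x) (hy : vertex k t * y = y) :
    comulVertex k v * (x ⊗ₜ y) = if s * t = v then x ⊗ₜ y else 0 := by
  rw [comulVertex, Finset.sum_mul, Finset.sum_eq_single s]
  · rw [Algebra.TensorProduct.tmul_mul_tmul, hx, vertex_mul_eq_ite hy, TensorProduct.tmul_ite]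
    simp only [inv_mul_eq_iff_eq_mul, eq_comm (a := v)]
  · intro b _ hb
    rw [Algebra.TensorProduct.tmul_mul_tmul, vertex_mul_eq_ite hx, if_neg hb,
      TensorProduct.zero_tmul]
  · simp

open Classical in
theorem tmul_mul_comulVertex (v : V) {s t : V} {x y : PathAlgebra k V}
    (hx : x * vertex k s = x) (hy : y * vertex k t = y) :
    (x ⊗ₜ y) * comulVertex k v = if s * t = v then x ⊗ₜ y else 0 := by
  rw [comulVertex, Finset.mul_sum, Finset.sum_eq_single s]
  · rw [Algebra.TensorProduct.tmul_mul_tmul, hx, mul_vertex_eq_ite hy, TensorProduct.tmul_ite]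
    simp only [inv_mul_eq_iff_eq_mul, eq_comm (a := v)]
  · intro b _ hb
    rw [Algebra.TensorProduct.tmul_mul_tmul, mul_vertex_eq_ite hx, if_neg hb,
      TensorProduct.zero_tmul]
  · simp

open Classical in
theorem comulVertex_mul_comulVertex (v w : V) :
    comulVertex k v * comulVertex k w = if v = w then comulVertex k v else 0 := by
  conv_lhs => arg 2; rw [comulVertex]
  simp only [Finset.mul_sum, comulVertex_mul_tmul v (vertex_mul_self _) (vertex_mul_self _),
    mul_inv_cancel_left, eq_comm (a := w)]
  split_ifs with h
  · subst h; rfl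
  · simp

theorem sum_comulVertex : ∑ v : V, comulVertex k v = 1 := by
  simp only [comulVertex]
  rw [Finset.sum_comm]
  simp only [← TensorProduct.tmul_sum]
  have h (x : V) : ∑ v : V, vertex k (x⁻¹ * v) = 1 :=
    Equiv.sum_comp (Equiv.mulLeft x⁻¹) (vertex k)
  simp only [h, ← TensorProduct.sum_tmul, ← one_eq_sum]
  rfl

variable [ArrowTranslation V]

open ArrowTranslation

/-- The comultiplication of an arrow. -/
def comulArrow (χ : V →* V →* kˣ) (e : QArrow V) : PathAlgebra k V ⊗[k] PathAlgebra k V :=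
  ∑ g : V, (vertex k g ⊗ₜ arrow k (g⁻¹ • e) +
    (χ g (arrowDegree e) : k) • (arrow k (g⁻¹ • e) ⊗ₜ vertex k g))

/-- Every summand of `comulArrow χ e` has endpoints g and g⁻¹ times an endpoint of e, with product
that endpoint of e. -/
theorem isRep_comul (χ : V →* V →* kˣ) : IsRep (comulVertex k) (comulArrow χ) where
  mul_self v := by rw [comulVertex_mul_comulVertex, if_pos rfl]
  mul_of_ne v w h := by rw [comulVertex_mul_comulVertex, if_neg h]
  sum_eq_one := sum_comulVertex
  tgt_mul e := by
    rw [comulArrow, Finset.mul_sum]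
    refine Finset.sum_congr rfl fun g _ => ?_
    rw [mul_add, mul_smul_comm, comulVertex_mul_tmul _ (vertex_mul_self _) (tgt_mul_arrow _),
      comulVertex_mul_tmul _ (tgt_mul_arrow _) (vertex_mul_self _), smul_tgt,
      mul_inv_cancel_left, mul_comm _ g, mul_inv_cancel_left, if_pos rfl, if_pos rfl]
  mul_src e := by
    rw [comulArrow, Finset.sum_mul]
    refine Finset.sum_congr rfl fun g _ => ?_
    rw [add_mul, smul_mul_assoc, tmul_mul_comulVertex _ (vertex_mul_self _) (arrow_mul_src _),
      tmul_mul_comulVertex _ (arrow_mul_src _) (vertex_mul_self _), smul_src,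
      mul_inv_cancel_left, mul_comm _ g, mul_inv_cancel_left, if_pos rfl, if_pos rfl]

/-- The comultiplication of the path algebra given by a bicharacter. -/
def comulHom (χ : V →* V →* kˣ) : PathAlgebra k V →ₐ[k] PathAlgebra k V ⊗[k] PathAlgebra k V :=
  (isRep_comul χ).lift k

theorem comulHom_vertex (χ : V →* V →* kˣ) (v : V) :
    comulHom χ (vertex k v) = ∑ x : V, vertex k x ⊗ₜ vertex k (x⁻¹ * v) :=
  (isRep_comul χ).lift_vertex v

theorem comulHom_arrow (χ : V →* V →* kˣ) (e : QArrow V) :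
    comulHom χ (arrow k e) = ∑ g : V, (vertex k g ⊗ₜ arrow k (g⁻¹ • e) +
      (χ g (arrowDegree e) : k) • (arrow k (g⁻¹ • e) ⊗ₜ vertex k g)) :=
  (isRep_comul χ).lift_arrow e

theorem comulHom_coassoc (χ : V →* V →* kˣ) :
    (Algebra.TensorProduct.assoc k k k _ _ _).toAlgHom.comp
      ((Algebra.TensorProduct.map (comulHom χ) (AlgHom.id k (PathAlgebra k V))).comp
        (comulHom χ)) =
    (Algebra.TensorProduct.map (AlgHom.id k _) (comulHom χ)).comp (comulHom χ) := by
  refine algHom_ext (fun v => ?_) fun e => ?_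
  · simp only [AlgHom.comp_apply, comulHom_vertex, map_sum, Algebra.TensorProduct.map_tmul,
      AlgHom.id_apply, TensorProduct.sum_tmul, TensorProduct.tmul_sum]
    simp only [AlgEquiv.toAlgHom_apply, Algebra.TensorProduct.assoc_tmul]
    rw [sum_sum_inv_mul fun x y g => vertex k x ⊗ₜ (vertex k y ⊗ₜ vertex k (g⁻¹ * v))]
    simp only [mul_inv_rev, mul_assoc, mul_left_comm]
  · simp only [AlgHom.comp_apply, comulHom_arrow, comulHom_vertex, map_sum, map_add, map_smul,
      Algebra.TensorProduct.map_tmul, AlgHom.id_apply, TensorProduct.sum_tmul,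
      TensorProduct.tmul_sum, TensorProduct.add_tmul, TensorProduct.tmul_add,
      ← TensorProduct.smul_tmul', TensorProduct.tmul_smul, arrowDegree_smul, Finset.sum_add_distrib,
      Finset.smul_sum, smul_add]
    simp only [AlgEquiv.toAlgHom_apply, Algebra.TensorProduct.assoc_tmul]
    rw [sum_sum_inv_mul fun x y g => vertex k x ⊗ₜ[k] (vertex k y ⊗ₜ[k] arrow k (g⁻¹ • e)),
      sum_sum_inv_mul fun x y g => (χ g (arrowDegree e) : k) •
        (arrow k (g⁻¹ • e) ⊗ₜ[k] (vertex k x ⊗ₜ[k] vertex k y))]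
    rw [add_assoc]
    -- The three sums have the arrow in the third, second and first leg. Only the last uses
    -- multiplicativity of χ, in its first variable; invariance of the degree under translation has
    -- already aligned the coefficients.
    refine congrArg₂ (· + ·) ?_ (congrArg₂ (· + ·) ?_ ?_)
    · refine Finset.sum_congr rfl fun x _ => Finset.sum_congr rfl fun y _ => ?_
      rw [mul_inv_rev, mul_smul]
    · rw [Finset.sum_comm]
      refine Finset.sum_congr rfl fun x _ => Finset.sum_congr rfl fun y _ => ?_
      rw [smul_comm]
    · rw [Finset.sum_comm]
      refine Finset.sum_congr rfl fun x _ => Finset.sum_congr rfl fun y _ => ?_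
      simp only [mul_inv_rev, mul_smul, map_mul, MonoidHom.mul_apply, Units.val_mul]
      rw [smul_comm, smul_smul x⁻¹, smul_smul y⁻¹, mul_comm x⁻¹]

end Comul

/-! ### Counit, antipode and R-matrix attached to a bicharacter -/

section Structure

variable {k : Type u} [CommRing k] {V : Type v} [Quiver.{w} V] [Fintype V] [CommGroup V]
  [ArrowTranslation V]

open ArrowTranslation

theorem comulHom_rTensor_counit (χ : V →* V →* kˣ) :
    (Algebra.TensorProduct.map (char k (1 : V)) (AlgHom.id k _)).comp (comulHom χ) =
      (Algebra.TensorProduct.lid k (PathAlgebra k V)).symm.toAlgHom := by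
  classical
  refine algHom_ext (fun v => ?_) fun e => ?_
  · simp [comulHom_vertex, char_vertex, TensorProduct.ite_tmul]
  · simp [comulHom_arrow, char_vertex, char_arrow, TensorProduct.ite_tmul]

theorem comulHom_lTensor_counit (χ : V →* V →* kˣ) :
    (Algebra.TensorProduct.map (AlgHom.id k _) (char k (1 : V))).comp (comulHom χ) =
      (Algebra.TensorProduct.rid k k (PathAlgebra k V)).symm.toAlgHom := by
  classical
  refine algHom_ext (fun v => ?_) fun e => ?_
  · simp [comulHom_vertex, char_vertex, TensorProduct.tmul_ite, inv_mul_eq_iff_eq_mul]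
  · simp [comulHom_arrow, char_vertex, char_arrow, TensorProduct.tmul_ite]

/-- The antipode of an arrow. -/
def antipodeArrow (χ : V →* V →* kˣ) (e : QArrow V) : PathAlgebra k V :=
  -((χ e.tgt (arrowDegree e) : k) • arrow k ((e.src⁻¹ * e.tgt⁻¹) • e))

/-- The opposite algebra is the target because S must reverse products. Translation by (source ·
target)⁻¹ makes the image of an arrow a → b run from b⁻¹ to a⁻¹, as reversal and inversion require.
-/
theorem isRep_antipode (χ : V →* V →* kˣ) :
    IsRep (fun v : V => MulOpposite.op (vertex k v⁻¹))
      (fun e : QArrow V => MulOpposite.op (antipodeArrow χ e)) where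
  mul_self v := by rw [← MulOpposite.op_mul, vertex_mul_self]
  mul_of_ne v w h := by
    rw [← MulOpposite.op_mul, vertex_mul_vertex, if_neg fun h' => h (inv_injective h').symm,
      MulOpposite.op_zero]
  sum_eq_one := by
    rw [← Finset.op_sum]
    exact congrArg MulOpposite.op (Equiv.sum_comp (Equiv.inv V) (vertex k))
  tgt_mul e := by
    rw [← MulOpposite.op_mul, antipodeArrow, neg_mul, smul_mul_assoc, arrow_mul_vertex,
      smul_src, if_pos (by rw [mul_comm e.src⁻¹, inv_mul_cancel_right])]
  mul_src e := by
    rw [← MulOpposite.op_mul, antipodeArrow, mul_neg, mul_smul_comm, vertex_mul_arrow,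
      smul_tgt, if_pos (by rw [inv_mul_cancel_right])]

/-- The antipode of the path algebra given by a bicharacter. -/
def antipodeMap (χ : V →* V →* kˣ) : PathAlgebra k V →ₗ[k] PathAlgebra k V :=
  (MulOpposite.opLinearEquiv k).symm.toLinearMap ∘ₗ ((isRep_antipode χ).lift k).toLinearMap

theorem antipodeMap_mul (χ : V →* V →* kˣ) (x y : PathAlgebra k V) :
    antipodeMap χ (x * y) = antipodeMap χ y * antipodeMap χ x := by
  simp [antipodeMap]

theorem antipodeMap_vertex (χ : V →* V →* kˣ) (v : V) :
    antipodeMap χ (vertex k v) = vertex k v⁻¹ := by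
  simp [antipodeMap, IsRep.lift_vertex]

theorem antipodeMap_arrow (χ : V →* V →* kˣ) (e : QArrow V) :
    antipodeMap χ (arrow k e) =
      -((χ e.tgt (arrowDegree e) : k) • arrow k ((e.src⁻¹ * e.tgt⁻¹) • e)) := by
  simp [antipodeMap, IsRep.lift_arrow, antipodeArrow]

theorem sum_arrow_inv_smul (e : QArrow V) : ∑ g : V, arrow k (g⁻¹ • e) = ∑ g : V, arrow k (g • e) :=
  Equiv.sum_comp (Equiv.inv V) fun g => arrow k (g • e)

/-- All terms vanish unless the target is 1. In that case the factors of χ cancel, and the two sums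
run over all translates of e with opposite signs. -/
theorem mul_antipode_rTensor_arrow (χ : V →* V →* kˣ) (e : QArrow V) :
    LinearMap.mul' k _ ((antipodeMap χ).rTensor _ (comulHom χ (arrow k e))) = 0 := by
  classical
  have h1 (g : V) : vertex k g⁻¹ * arrow k (g⁻¹ • e) =
      if e.tgt = 1 then arrow k (g⁻¹ • e) else 0 := by
    rw [vertex_mul_arrow, smul_tgt]
    simp only [mul_eq_left]
  have h2 (g : V) : (χ g (arrowDegree e) : k) • (antipodeMap χ (arrow k (g⁻¹ • e)) * vertex k g) =
      if e.tgt = 1 then -arrow k ((g * e.src⁻¹) • e) else 0 := by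
    rw [antipodeMap_arrow, neg_mul, smul_mul_assoc, arrow_mul_vertex, arrowDegree_smul]
    simp only [smul_src, smul_tgt]
    have h3 : (g⁻¹ * e.src)⁻¹ * (g⁻¹ * e.tgt)⁻¹ * (g⁻¹ * e.src) = g * e.tgt⁻¹ := by
      rw [mul_comm (g⁻¹ * e.src)⁻¹, inv_mul_cancel_right, mul_inv_rev, inv_inv, mul_comm]
    simp only [h3, mul_eq_left, inv_eq_one]
    split_ifs with h
    · rw [smul_neg, smul_smul, ← Units.val_mul, ← MonoidHom.mul_apply, ← map_mul, h, mul_one,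
        mul_inv_cancel, map_one, MonoidHom.one_apply, Units.val_one, one_smul, smul_smul]
      congr 3
      rw [inv_inv, mul_inv_rev, inv_inv, mul_assoc, mul_inv_cancel, mul_one, mul_comm]
    · simp
  simp only [comulHom_arrow, map_sum, map_add, map_smul, LinearMap.rTensor_tmul,
    LinearMap.mul'_apply, antipodeMap_vertex, h1, h2]
  split_ifs
  · rw [Finset.sum_add_distrib, sum_arrow_inv_smul, Finset.sum_neg_distrib, add_neg_eq_zero]
    exact (Equiv.sum_comp (Equiv.mulRight e.src⁻¹) fun g => arrow k (g • e)).symm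
  · simp

/-- Here the source must be 1. The factors of χ do not cancel termwise; the sums match after the
substitution g ↦ g⁻¹ · target. -/
theorem mul_antipode_lTensor_arrow (χ : V →* V →* kˣ) (e : QArrow V) :
    LinearMap.mul' k _ ((antipodeMap χ).lTensor _ (comulHom χ (arrow k e))) = 0 := by
  classical
  have h1 (g : V) : vertex k g * antipodeMap χ (arrow k (g⁻¹ • e)) =
      if e.src = 1 then -((χ (g⁻¹ * e.tgt) e.tgt : k) • arrow k ((g * e.tgt⁻¹) • e)) else 0 := by
    rw [antipodeMap_arrow, mul_neg, mul_smul_comm, vertex_mul_arrow, arrowDegree_smul]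
    simp only [smul_src, smul_tgt]
    have h3 : (g⁻¹ * e.src)⁻¹ * (g⁻¹ * e.tgt)⁻¹ * (g⁻¹ * e.tgt) = g * e.src⁻¹ := by
      rw [inv_mul_cancel_right, mul_inv_rev, inv_inv, mul_comm]
    simp only [h3, mul_eq_left, inv_eq_one]
    split_ifs with h
    · rw [smul_smul, arrowDegree, h, inv_one, mul_one]
      congr 4
      rw [mul_one, inv_inv, mul_inv_rev, inv_inv, ← mul_assoc, mul_inv_cancel_right]
    · simp
  have h2 (g : V) : (χ g (arrowDegree e) : k) • (arrow k (g⁻¹ • e) * vertex k g⁻¹) =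
      if e.src = 1 then (χ g e.tgt : k) • arrow k (g⁻¹ • e) else 0 := by
    rw [arrow_mul_vertex, smul_src]
    simp only [mul_eq_left]
    split_ifs with h
    · rw [arrowDegree, h, inv_one, mul_one]
    · simp
  simp only [comulHom_arrow, map_sum, map_add, map_smul, LinearMap.lTensor_tmul,
    LinearMap.mul'_apply, antipodeMap_vertex, h1, h2]
  split_ifs
  · rw [Finset.sum_add_distrib, Finset.sum_neg_distrib, neg_add_eq_zero,
      ← Equiv.sum_comp ((Equiv.inv V).trans (Equiv.mulRight e.tgt))]
    simp
  · simp

/-- Since S(u₁x)u₂y = S(x)(S(u₁)u₂)y, a scalar in the middle can be pulled out. This propagates the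
antipode axiom along products, which `algHom_ext` cannot do because neither side of the axiom is
presented as an algebra map. In the mirror version the scalar comes from the right factor. -/
theorem mul'_rTensor_mul (χ : V →* V →* kˣ) {U : PathAlgebra k V ⊗[k] PathAlgebra k V} {c : k}
    (hU : LinearMap.mul' k _ ((antipodeMap χ).rTensor _ U) = algebraMap k _ c)
    (T : PathAlgebra k V ⊗[k] PathAlgebra k V) :
    LinearMap.mul' k _ ((antipodeMap χ).rTensor _ (U * T)) =
      c • LinearMap.mul' k _ ((antipodeMap χ).rTensor _ T) := by
  have key : ∀ x y, LinearMap.mul' k _ ((antipodeMap χ).rTensor _ (U * x ⊗ₜ y)) =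
      antipodeMap χ x * LinearMap.mul' k _ ((antipodeMap χ).rTensor _ U) * y := by
    intro x y
    clear hU
    induction U with
    | zero => simp
    | add a b ha hb => simp only [add_mul, map_add, ha, hb, mul_add]
    | tmul a b => simp [antipodeMap_mul, mul_assoc]
  induction T with
  | zero => simp
  | add a b ha hb => simp only [mul_add, map_add, ha, hb, smul_add]
  | tmul x y => simp [key, hU, ← Algebra.commutes, Algebra.smul_def, mul_assoc]

theorem mul'_lTensor_mul (χ : V →* V →* kˣ) {U : PathAlgebra k V ⊗[k] PathAlgebra k V} {c : k}
    (hU : LinearMap.mul' k _ ((antipodeMap χ).lTensor _ U) = algebraMap k _ c)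
    (T : PathAlgebra k V ⊗[k] PathAlgebra k V) :
    LinearMap.mul' k _ ((antipodeMap χ).lTensor _ (T * U)) =
      c • LinearMap.mul' k _ ((antipodeMap χ).lTensor _ T) := by
  have key : ∀ x y, LinearMap.mul' k _ ((antipodeMap χ).lTensor _ (x ⊗ₜ y * U)) =
      x * LinearMap.mul' k _ ((antipodeMap χ).lTensor _ U) * antipodeMap χ y := by
    intro x y
    clear hU
    induction U with
    | zero => simp
    | add a b ha hb => simp only [add_mul, map_add, ha, hb, mul_add]
    | tmul a b => simp [antipodeMap_mul, mul_assoc]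
  induction T with
  | zero => simp
  | add a b ha hb => simp only [add_mul, map_add, ha, hb, smul_add]
  | tmul x y => simp [key, hU, ← Algebra.commutes, Algebra.smul_def, mul_assoc]

theorem mul_antipode_rTensor_comulHom (χ : V →* V →* kˣ) :
    LinearMap.mul' k _ ∘ₗ (antipodeMap χ).rTensor _ ∘ₗ (comulHom χ).toLinearMap =
      Algebra.linearMap k (PathAlgebra k V) ∘ₗ (char k (1 : V)).toLinearMap := by
  classical
  ext a
  refine mem_of_generators {a | (LinearMap.mul' k _ ∘ₗ (antipodeMap χ).rTensor _ ∘ₗ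
    (comulHom χ).toLinearMap) a = (Algebra.linearMap k _ ∘ₗ (char k (1 : V)).toLinearMap) a}
    (fun x hx y hy => ?_) (fun c x hx => ?_) (fun v => ?_) (fun e x hx => ?_) ?_ a
  · simp only [Set.mem_ofPred_eq] at hx hy ⊢
    rw [map_add, map_add, hx, hy]
  · simp only [Set.mem_ofPred_eq] at hx ⊢
    rw [map_smul, map_smul, hx]
  · simp only [Set.mem_ofPred_eq, LinearMap.comp_apply, AlgHom.toLinearMap_apply, comulHom_vertex,
      map_sum, LinearMap.rTensor_tmul, LinearMap.mul'_apply, antipodeMap_vertex, vertex_mul_vertex,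
      char_vertex, left_eq_mul, Algebra.linearMap_apply]
    split_ifs
    · rw [map_one]
      exact Equiv.sum_comp (Equiv.inv V) (vertex k)
    · simp
  · simp only [Set.mem_ofPred_eq, LinearMap.comp_apply, AlgHom.toLinearMap_apply, map_mul,
      char_arrow, zero_mul, map_zero]
    rw [mul'_rTensor_mul χ (c := 0) (by rw [mul_antipode_rTensor_arrow, map_zero]), zero_smul]
  · simp

theorem mul_antipode_lTensor_comulHom (χ : V →* V →* kˣ) :
    LinearMap.mul' k _ ∘ₗ (antipodeMap χ).lTensor _ ∘ₗ (comulHom χ).toLinearMap =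
      Algebra.linearMap k (PathAlgebra k V) ∘ₗ (char k (1 : V)).toLinearMap := by
  classical
  ext a
  refine mem_of_generators {a | (LinearMap.mul' k _ ∘ₗ (antipodeMap χ).lTensor _ ∘ₗ
    (comulHom χ).toLinearMap) a = (Algebra.linearMap k _ ∘ₗ (char k (1 : V)).toLinearMap) a}
    (fun x hx y hy => ?_) (fun c x hx => ?_) (fun v => ?_) (fun e x hx => ?_) ?_ a
  · simp only [Set.mem_ofPred_eq] at hx hy ⊢
    rw [map_add, map_add, hx, hy]
  · simp only [Set.mem_ofPred_eq] at hx ⊢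
    rw [map_smul, map_smul, hx]
  · simp only [Set.mem_ofPred_eq, LinearMap.comp_apply, AlgHom.toLinearMap_apply, comulHom_vertex,
      map_sum, LinearMap.lTensor_tmul, LinearMap.mul'_apply, antipodeMap_vertex, vertex_mul_vertex,
      char_vertex, mul_inv_rev, inv_inv, right_eq_mul, inv_eq_one, Algebra.linearMap_apply]
    split_ifs
    · rw [map_one]
      rfl
    · simp
  · simp only [Set.mem_ofPred_eq, LinearMap.comp_apply, AlgHom.toLinearMap_apply, map_mul,
      char_arrow, zero_mul, map_zero, Algebra.linearMap_apply] at hx ⊢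
    rw [mul'_lTensor_mul χ hx, mul_antipode_lTensor_arrow, smul_zero]
  · simp

/-- The Hopf structure on the path algebra given by a bicharacter. -/
def bicharHopf (χ : V →* V →* kˣ) : HopfStructure k (PathAlgebra k V) where
  comul := comulHom χ
  counit := char k 1
  antipode := antipodeMap χ
  coassoc := comulHom_coassoc χ
  rTensor_counit_comp_comul := comulHom_rTensor_counit χ
  lTensor_counit_comp_comul := comulHom_lTensor_counit χ
  mul_antipode_rTensor_comul := mul_antipode_rTensor_comulHom χ
  mul_antipode_lTensor_comul := mul_antipode_lTensor_comulHom χ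

theorem bicharHopf_isGraded (χ : V →* V →* kˣ) : (bicharHopf χ).IsGraded (grade k V) where
  comul_mem := by
    refine forall_mem_grade (comulHom χ).toLinearMap
      (fun n => ⨆ (i : ℕ) (j : ℕ) (_ : i + j = n), tensorSub (grade k V i) (grade k V j))
      (fun v => ?_) fun n e x hx => ?_
    · rw [AlgHom.toLinearMap_apply, comulHom_vertex]
      exact sum_mem fun x _ => tmul_mem_iSup 0 0 rfl (vertex_mem_grade _) (vertex_mem_grade _)
    · rw [AlgHom.toLinearMap_apply] at hx ⊢
      rw [map_mul, comulHom_arrow]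
      refine iSup_tensorSub_induction (P := fun t => (∑ g : V, (vertex k g ⊗ₜ arrow k (g⁻¹ • e) +
        (χ g (arrowDegree e) : k) • (arrow k (g⁻¹ • e) ⊗ₜ vertex k g))) * t ∈
        ⨆ (i : ℕ) (j : ℕ) (_ : i + j = n + 1), tensorSub (grade k V i) (grade k V j)) ?_ ?_ ?_ hx
      · simp
      · intro x y hx hy
        rw [mul_add]
        exact add_mem hx hy
      · intro i j hij x hx y hy
        rw [Finset.sum_mul]
        refine sum_mem fun g _ => ?_
        rw [add_mul, smul_mul_assoc, Algebra.TensorProduct.tmul_mul_tmul,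
          Algebra.TensorProduct.tmul_mul_tmul]
        refine add_mem (tmul_mem_iSup (0 + i) (1 + j) (by omega) ?_ ?_)
          (Submodule.smul_mem _ _ (tmul_mem_iSup (1 + i) (0 + j) (by omega) ?_ ?_))
        · exact grade_mul_mem (vertex_mem_grade _) hx
        · exact grade_mul_mem (arrow_mem_grade _) hy
        · exact grade_mul_mem (arrow_mem_grade _) hx
        · exact grade_mul_mem (vertex_mem_grade _) hy
  counit_eq_zero n hn a ha := char_grade 1 hn ha
  antipode_mem := by
    refine forall_mem_grade (antipodeMap χ) (grade k V) (fun v => ?_) fun n e x hx => ?_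
    · rw [antipodeMap_vertex]
      exact vertex_mem_grade _
    · rw [antipodeMap_mul, antipodeMap_arrow]
      exact grade_mul_mem hx (neg_mem (Submodule.smul_mem _ _ (arrow_mem_grade _)))

/-- The universal R-matrix given by a bicharacter. -/
def bicharR (χ : V →* V →* kˣ) : (PathAlgebra k V ⊗[k] PathAlgebra k V)ˣ where
  val := diagonalTensor fun g h => (χ g h : k)
  inv := diagonalTensor fun g h => ((χ g h)⁻¹ : kˣ)
  val_inv := by simp [diagonalTensor_mul, diagonalTensor_one]
  inv_val := by simp [diagonalTensor_mul, diagonalTensor_one]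

/-- The flip exchanges the two kinds of terms in Δ(e), so scalars are compared in pairs. One
comparison (`h1`) is bimultiplicativity alone; the other (`h2`) is where skew-symmetry enters. -/
theorem comul_op_arrow {χ : V →* V →* kˣ} (hχ : ∀ g h, χ g h * χ h g = 1) (e : QArrow V) :
    Algebra.TensorProduct.comm k _ _ (comulHom χ (arrow k e)) *
        (bicharR χ : PathAlgebra k V ⊗[k] PathAlgebra k V) =
      (bicharR χ : PathAlgebra k V ⊗[k] PathAlgebra k V) * comulHom χ (arrow k e) := by
  have ht : e.tgt = arrowDegree e * e.src := by rw [arrowDegree, inv_mul_cancel_right]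
  simp only [comulHom_arrow, map_sum, map_add, map_smul, Algebra.TensorProduct.comm_tmul,
    Finset.sum_mul, Finset.mul_sum, add_mul, mul_add, bicharR, smul_mul_assoc, mul_smul_comm,
    tmul_mul_diagonalTensor _ (vertex_mul_self _) (arrow_mul_src _),
    tmul_mul_diagonalTensor _ (arrow_mul_src _) (vertex_mul_self _),
    diagonalTensor_mul_tmul _ (vertex_mul_self _) (tgt_mul_arrow _),
    diagonalTensor_mul_tmul _ (tgt_mul_arrow _) (vertex_mul_self _), smul_src, smul_tgt, smul_smul]
  refine Finset.sum_congr rfl fun g _ => ?_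
  have h1 : χ g (arrowDegree e) * χ g (g⁻¹ * e.src) = χ g (g⁻¹ * e.tgt) := by
    rw [← map_mul, ht, mul_left_comm]
  have h2 : χ (g⁻¹ * e.src) g = χ g (arrowDegree e) * χ (g⁻¹ * e.tgt) g := by
    rw [ht, mul_left_comm, map_mul χ (arrowDegree e), MonoidHom.mul_apply, ← mul_assoc,
      hχ, one_mul]
  rw [add_comm, ← Units.val_mul, ← Units.val_mul, h1, h2]

theorem comul_op_vertex {χ : V →* V →* kˣ} (v : V) :
    Algebra.TensorProduct.comm k _ _ (comulHom χ (vertex k v)) *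
        (bicharR χ : PathAlgebra k V ⊗[k] PathAlgebra k V) =
      (bicharR χ : PathAlgebra k V ⊗[k] PathAlgebra k V) * comulHom χ (vertex k v) := by
  simp only [comulHom_vertex, map_sum, Algebra.TensorProduct.comm_tmul,
    Finset.sum_mul, Finset.mul_sum, bicharR,
    tmul_mul_diagonalTensor _ (vertex_mul_self _) (vertex_mul_self _),
    diagonalTensor_mul_tmul _ (vertex_mul_self _) (vertex_mul_self _)]
  rw [← Equiv.sum_comp ((Equiv.inv V).trans (Equiv.mulRight v))]
  simp

theorem comul_op_mul {χ : V →* V →* kˣ} (hχ : ∀ g h, χ g h * χ h g = 1) (a : PathAlgebra k V) :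
    Algebra.TensorProduct.comm k _ _ (comulHom χ a) *
        (bicharR χ : PathAlgebra k V ⊗[k] PathAlgebra k V) =
      (bicharR χ : PathAlgebra k V ⊗[k] PathAlgebra k V) * comulHom χ a := by
  refine mem_of_generators {a | Algebra.TensorProduct.comm k _ _ (comulHom χ a) *
        (bicharR χ : PathAlgebra k V ⊗[k] PathAlgebra k V) =
      (bicharR χ : PathAlgebra k V ⊗[k] PathAlgebra k V) * comulHom χ a}
    (fun x hx y hy => ?_) (fun c x hx => ?_) comul_op_vertex (fun e x hx => ?_) ?_ a
  · simp only [Set.mem_ofPred_eq] at hx hy ⊢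
    rw [map_add, map_add, add_mul, mul_add, hx, hy]
  · simp only [Set.mem_ofPred_eq] at hx ⊢
    rw [map_smul, map_smul, smul_mul_assoc, mul_smul_comm, hx]
  · simp only [Set.mem_ofPred_eq] at hx ⊢
    rw [map_mul, map_mul, mul_assoc, hx, ← mul_assoc, comul_op_arrow hχ, mul_assoc]
  · simp

/-- The two coproduct axioms are the multiplicativity of χ in its first and in its second variable.
-/
theorem bicharR_isUniversalRMatrix {χ : V →* V →* kˣ} (hχ : ∀ g h, χ g h * χ h g = 1) :
    (bicharHopf χ).IsUniversalRMatrix (bicharR χ) where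
  comul_left := by
    simp only [bicharR, bicharHopf, leg23_diagonalTensor, Finset.mul_sum, mul_smul_comm,
      leg13_mul_tmul]
    simp only [diagonalTensor, map_sum, map_smul, Algebra.TensorProduct.map_tmul, AlgHom.id_apply,
      comulHom_vertex, TensorProduct.sum_tmul, Algebra.TensorProduct.assoc_tmul, Finset.smul_sum]
    have h (g : V) : ∑ z : V, ∑ x : V, (χ g z : k) •
        (vertex k x ⊗ₜ[k] (vertex k (x⁻¹ * g) ⊗ₜ[k] vertex k z)) =
        ∑ x : V, ∑ z : V, (χ g z : k) •
        (vertex k x ⊗ₜ[k] (vertex k (x⁻¹ * g) ⊗ₜ[k] vertex k z)) := Finset.sum_comm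
    simp only [h]
    rw [sum_sum_inv_mul fun x y g => ∑ z : V, (χ g z : k) •
      (vertex k x ⊗ₜ[k] (vertex k y ⊗ₜ[k] vertex k z))]
    simp [smul_smul, mul_comm]
  comul_right := by
    simp only [bicharR, bicharHopf, leg12_diagonalTensor, Finset.mul_sum, mul_smul_comm,
      leg13_mul_tmul]
    simp only [diagonalTensor, map_sum, map_smul, Algebra.TensorProduct.map_tmul, AlgHom.id_apply,
      comulHom_vertex, TensorProduct.tmul_sum, Finset.smul_sum]
    refine Finset.sum_congr rfl fun x _ => ?_
    rw [sum_sum_inv_mul fun y z g => (χ x g : k) •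
      (vertex k x ⊗ₜ[k] (vertex k y ⊗ₜ[k] vertex k z))]
    simp [smul_smul]
  comul_op h := by
    rw [Units.eq_mul_inv_iff_mul_eq]
    exact comul_op_mul hχ h

/-- The graded quasitriangular structure on the path algebra given by a skew-symmetric
bicharacter. -/
def bicharStructure (χ : V →* V →* kˣ) (hχ : ∀ g h, χ g h * χ h g = 1) :
    GradedQuasitriangular k V where
  hopf := bicharHopf χ
  isGraded := bicharHopf_isGraded χ
  R := bicharR χ
  isUniversalRMatrix := bicharR_isUniversalRMatrix hχ

end Structure

end PathAlgebra

/-! ### Compatibility with antipodes -/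

section Antipode

variable {k : Type u} [CommRing k] {A : Type v} [Ring A] [Algebra k A]

/-- Isomorphisms of bialgebras preserve the antipode. -/
theorem HopfStructure.map_antipode (H H' : HopfStructure k A) (φ : A →ₐ[k] A)
    (hcomul : ∀ a, Algebra.TensorProduct.map φ φ (H.comul a) = H'.comul (φ a))
    (hcounit : ∀ a, H'.counit (φ a) = H.counit a) (a : A) :
    φ (H.antipode a) = H'.antipode (φ a) := by
  let _ : HopfAlgebra k A := H.toHopfAlgebra
  have h1 : WithConv.toConv (φ.toLinearMap ∘ₗ H.antipode) * WithConv.toConv φ.toLinearMap =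
      (1 : WithConv (A →ₗ[k] A)) := by
    ext a
    have h := congrArg φ (LinearMap.congr_fun H.mul_antipode_rTensor_comul a)
    simp only [LinearMap.comp_apply, AlgHom.toLinearMap_apply, Algebra.linearMap_apply,
      AlgHom.commutes] at h
    refine Eq.trans ?_ h
    change LinearMap.mul' k A (TensorProduct.map _ _ (H.comul a)) = _
    generalize H.comul a = t
    induction t with
    | zero => simp
    | add x y hx hy => simp only [map_add, hx, hy]
    | tmul x y => simp
  have h2 : WithConv.toConv φ.toLinearMap * WithConv.toConv (H'.antipode ∘ₗ φ.toLinearMap) =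
      (1 : WithConv (A →ₗ[k] A)) := by
    ext a
    have h := LinearMap.congr_fun H'.mul_antipode_lTensor_comul (φ a)
    simp only [LinearMap.comp_apply, AlgHom.toLinearMap_apply, Algebra.linearMap_apply,
      hcounit, ← hcomul] at h
    refine Eq.trans ?_ h
    change LinearMap.mul' k A (TensorProduct.map _ _ (H.comul a)) = _
    generalize H.comul a = t
    induction t with
    | zero => simp
    | add x y hx hy => simp only [map_add, hx, hy]
    | tmul x y => simp
  -- φ ∘ S and S' ∘ φ are a left and a right inverse of φ in the convolution algebra, hence equal.
  have h3 := left_inv_eq_right_inv h1 h2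
  exact LinearMap.congr_fun (WithConv.toConv_injective h3) a

end Antipode

/-! ### Arrow translations on Hopf quivers, and the first assertion -/

section HopfQuiver

variable {G : Type v} [CommGroup G] {S : ConjClasses G → ℕ}

instance : CommGroup (HopfQuiver G S) := inferInstanceAs (CommGroup G)

/-- The arrow of the Hopf quiver from `a` to `b` with a given index. -/
def hopfArrow (a b : HopfQuiver G S) (i : Fin (S (ConjClasses.mk (b * a⁻¹ : G)))) :
    QArrow (HopfQuiver G S) :=
  ⟨a, b, i⟩

/-- The index of an arrow of the Hopf quiver. -/
def QArrow.index (e : QArrow (HopfQuiver G S)) :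
    Fin (S (ConjClasses.mk (e.tgt * e.src⁻¹ : G))) :=
  e.hom

theorem hopfQuiver_arrow_ext {e f : QArrow (HopfQuiver G S)} (h1 : e.src = f.src)
    (h2 : e.tgt = f.tgt) (h3 : (e.index : ℕ) = f.index) : e = f := by
  obtain ⟨a, b, e⟩ := e
  obtain ⟨c, d, f⟩ := f
  dsimp at h1 h2
  subst h1 h2
  exact congrArg _ (Fin.ext h3)

instance : ArrowTranslation (HopfQuiver G S) where
  smul g e := hopfArrow (g * e.src) (g * e.tgt) (Fin.cast (by
    congr 2
    rw [mul_inv_rev, mul_comm g, mul_assoc, mul_comm e.src⁻¹, mul_inv_cancel_left]) e.index)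
  one_smul e := hopfQuiver_arrow_ext (one_mul _) (one_mul _) rfl
  mul_smul g h e := hopfQuiver_arrow_ext (mul_assoc _ _ _) (mul_assoc _ _ _) rfl
  smul_src _ _ := rfl
  smul_tgt _ _ := rfl

end HopfQuiver

section Transport

variable {V : Type v} [Quiver.{w} V] {W : Type*} [Quiver W]

/-- The map on arrows given by an isomorphism of quivers. -/
def QuiverIso.mapArrow (F : QuiverIso V W) (e : QArrow V) : QArrow W :=
  ⟨F.vertexEquiv e.src, F.vertexEquiv e.tgt, F.arrowEquiv _ _ e.hom⟩

theorem QuiverIso.mapArrow_bijective (F : QuiverIso V W) : Function.Bijective F.mapArrow := by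
  constructor
  · rintro ⟨a, b, e⟩ ⟨c, d, f⟩ h
    simp only [QuiverIso.mapArrow, QArrow.mk.injEq] at h
    obtain ⟨h1, h2, h3⟩ := h
    obtain rfl := F.vertexEquiv.injective h1
    obtain rfl := F.vertexEquiv.injective h2
    exact congrArg _ ((F.arrowEquiv _ _).injective (eq_of_heq h3))
  · rintro ⟨a, b, e⟩
    obtain ⟨a, rfl⟩ := F.vertexEquiv.surjective a
    obtain ⟨b, rfl⟩ := F.vertexEquiv.surjective b
    obtain ⟨e, rfl⟩ := (F.arrowEquiv _ _).surjective e
    exact ⟨⟨a, b, e⟩, rfl⟩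

/-- The bijection on arrows given by an isomorphism of quivers. -/
def QuiverIso.arrowsEquiv (F : QuiverIso V W) : QArrow V ≃ QArrow W :=
  Equiv.ofBijective _ F.mapArrow_bijective

/-- Translations of arrows transported along an isomorphism of quivers. -/
abbrev QuiverIso.arrowTranslation [CommGroup W] [ArrowTranslation W] (F : QuiverIso V W) :
    letI : CommGroup V := F.vertexEquiv.commGroup
    ArrowTranslation V :=
  letI : CommGroup V := F.vertexEquiv.commGroup
  { smul := fun g e => F.arrowsEquiv.symm (F.vertexEquiv g • F.arrowsEquiv e)
    one_smul := fun e => by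
      change F.arrowsEquiv.symm (F.vertexEquiv (F.vertexEquiv.symm 1) • F.arrowsEquiv e) = e
      rw [Equiv.apply_symm_apply, one_smul, Equiv.symm_apply_apply]
    mul_smul := fun g h e => by
      change F.arrowsEquiv.symm (F.vertexEquiv (F.vertexEquiv.symm
        (F.vertexEquiv g * F.vertexEquiv h)) • F.arrowsEquiv e) = F.arrowsEquiv.symm
        (F.vertexEquiv g • F.arrowsEquiv (F.arrowsEquiv.symm (F.vertexEquiv h • F.arrowsEquiv e)))
      rw [Equiv.apply_symm_apply, Equiv.apply_symm_apply, mul_smul]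
    smul_src := fun g e => by
      refine F.vertexEquiv.injective ?_
      change (F.arrowsEquiv (F.arrowsEquiv.symm (F.vertexEquiv g • F.arrowsEquiv e))).src =
        F.vertexEquiv (F.vertexEquiv.symm (F.vertexEquiv g * F.vertexEquiv e.src))
      rw [Equiv.apply_symm_apply, Equiv.apply_symm_apply, ArrowTranslation.smul_src]
      rfl
    smul_tgt := fun g e => by
      refine F.vertexEquiv.injective ?_
      change (F.arrowsEquiv (F.arrowsEquiv.symm (F.vertexEquiv g • F.arrowsEquiv e))).tgt =
        F.vertexEquiv (F.vertexEquiv.symm (F.vertexEquiv g * F.vertexEquiv e.tgt))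
      rw [Equiv.apply_symm_apply, Equiv.apply_symm_apply, ArrowTranslation.smul_tgt]
      rfl }

end Transport

/-- The path algebra of a finite quiver admits a graded quasitriangular structure if and only if the
quiver is a Hopf quiver of an abelian group. -/
theorem nonempty_gradedQuasitriangular_iff {k : Type u} [Field k] (V : Type v) [Quiver.{w} V]
    [Fintype V] [∀ a b : V, Finite (a ⟶ b)] :
    Nonempty (GradedQuasitriangular k V) ↔
      ∃ (G : Type v) (_ : CommGroup G) (S : ConjClasses G → ℕ),
        Nonempty (QuiverIso V (HopfQuiver G S)) := by
  constructor
  · rintro ⟨X⟩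
    obtain ⟨_, hc⟩ := PathAlgebra.exists_commGroup_isCharGroup X
    obtain ⟨S, hS⟩ := hc.exists_quiverIso X.isGraded
    exact ⟨V, _, S, hS⟩
  · rintro ⟨G, _, S, ⟨F⟩⟩
    let _ : CommGroup V := F.vertexEquiv.commGroup
    let _ : ArrowTranslation V := F.arrowTranslation
    exact ⟨PathAlgebra.bicharStructure 1 fun _ _ => mul_one _⟩

/-! ### The bicharacter of an R-matrix -/

namespace PathAlgebra

section RMatrix

variable {k : Type u} [CommRing k] {V : Type v} [Quiver.{w} V] [Fintype V]

theorem eq_diagonalTensor {T : PathAlgebra k V ⊗[k] PathAlgebra k V}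
    (hT : T ∈ tensorSub (grade k V 0) (grade k V 0)) :
    T = diagonalTensor fun g h => charProd (char k g) (char k h) T := by
  refine tensorSub_induction (P := fun T => T = diagonalTensor fun g h =>
    charProd (char k g) (char k h) T) (by simp [diagonalTensor]) ?_ ?_ hT
  · intro x y hx hy
    conv_lhs => rw [hx, hy]
    simp [diagonalTensor, add_smul, Finset.sum_add_distrib]
  · intro x hx y hy
    conv_lhs => rw [eq_sum_of_mem_grade_zero hx, eq_sum_of_mem_grade_zero hy]
    simp only [diagonalTensor, TensorProduct.sum_tmul, TensorProduct.tmul_sum,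
      TensorProduct.tmul_smul, ← TensorProduct.smul_tmul', Finset.smul_sum, smul_smul,
      charProd_tmul]
    rw [Finset.sum_comm]
    simp only [mul_comm]

theorem evalLeft_diagonalTensor (f : V → V → k) (g : V) :
    evalLeft (char k g) _ (diagonalTensor f) = ∑ h, f g h • vertex k h := by
  classical
  simp [diagonalTensor, char_vertex]

theorem evalRight_diagonalTensor (f : V → V → k) (g : V) :
    evalRight (char k g) _ (diagonalTensor f) = ∑ h, f h g • vertex k h := by
  classical
  simp [diagonalTensor, char_vertex]

theorem sum_smul_vertex_mul (f : V → k) {s : V} {x : PathAlgebra k V} (hx : vertex k s * x = x) :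
    (∑ h, f h • vertex k h) * x = f s • x := by
  classical
  simp [Finset.sum_mul, vertex_mul_eq_ite hx]

theorem mul_sum_smul_vertex (f : V → k) {s : V} {x : PathAlgebra k V} (hx : x * vertex k s = x) :
    x * (∑ h, f h • vertex k h) = f s • x := by
  classical
  simp [Finset.mul_sum, mul_vertex_eq_ite hx]

variable {A : Type v} [Ring A] [Algebra k A]

/-- This and the next four lemmas turn the R-matrix axioms in the triple tensor product into
identities between scalars. -/
theorem charProd_assoc_map (H : HopfStructure k A) (φ ψ θ : A →ₐ[k] k) (T : A ⊗[k] A) :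
    charProd φ (charProd ψ θ) (Algebra.TensorProduct.assoc k k k A A A
      (Algebra.TensorProduct.map H.comul (AlgHom.id k A) T)) =
      charProd (H.convChar φ ψ) θ T := by
  induction T with
  | zero => simp
  | add x y hx hy => simp only [map_add, hx, hy]
  | tmul x y =>
    simp only [Algebra.TensorProduct.map_tmul, AlgHom.id_apply, charProd_tmul,
      HopfStructure.convChar, AlgHom.comp_apply]
    generalize H.comul x = t
    induction t with
    | zero => simp
    | add x y hx hy => simp only [map_add, hx, hy, TensorProduct.add_tmul, add_mul]
    | tmul a b => simp [mul_assoc]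

theorem charProd_map (H : HopfStructure k A) (φ ψ θ : A →ₐ[k] k) (T : A ⊗[k] A) :
    charProd φ (charProd ψ θ) (Algebra.TensorProduct.map (AlgHom.id k A) H.comul T) =
      charProd φ (H.convChar ψ θ) T := by
  induction T with
  | zero => simp
  | add x y hx hy => simp only [map_add, hx, hy]
  | tmul x y => simp [HopfStructure.convChar]

theorem charProd_leg12 (φ ψ θ : A →ₐ[k] k) (T : A ⊗[k] A) :
    charProd φ (charProd ψ θ) (leg12 k A T) = charProd φ ψ T := by
  induction T with
  | zero => simp
  | add x y hx hy => simp only [map_add, hx, hy]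
  | tmul x y => simp [leg12]

theorem charProd_leg13 (φ ψ θ : A →ₐ[k] k) (T : A ⊗[k] A) :
    charProd φ (charProd ψ θ) (leg13 k A T) = charProd φ θ T := by
  induction T with
  | zero => simp
  | add x y hx hy => simp only [map_add, hx, hy]
  | tmul x y => simp [leg13]

theorem charProd_leg23 (φ ψ θ : A →ₐ[k] k) (T : A ⊗[k] A) :
    charProd φ (charProd ψ θ) (leg23 k A T) = charProd ψ θ T := by
  simp [leg23]

theorem comm_comul_mul {H : HopfStructure k A} {R : (A ⊗[k] A)ˣ}
    (hR : H.IsUniversalRMatrix R) (a : A) :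
    Algebra.TensorProduct.comm k _ _ (H.comul a) * R = R * H.comul a := by
  rw [hR.comul_op, mul_assoc, Units.inv_mul, mul_one]

variable [CommGroup V] {H : HopfStructure k (PathAlgebra k V)}
  {R : (PathAlgebra k V ⊗[k] PathAlgebra k V)ˣ}

/-- The bicharacter given by a universal R-matrix. -/
def rBichar (hc : IsCharGroup H) (hR : H.IsUniversalRMatrix R) : V →* V →* kˣ :=
  MonoidHom.mk' (fun g => MonoidHom.mk'
    -- The entry is a unit because an algebra map sends the unit R to a unit.
    (fun h => Units.map (charProd (char k g) (char k h) : _ →* k) R) fun h l => by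
      ext
      have := congrArg (charProd (char k g) (charProd (char k h) (char k l))) hR.comul_right
      rw [charProd_map, map_mul, charProd_leg13, charProd_leg12, hc.convChar_char] at this
      exact this.trans (mul_comm _ _)) fun g h => by
    ext l
    have := congrArg (charProd (char k g) (charProd (char k h) (char k l))) hR.comul_left
    rw [charProd_assoc_map, map_mul, charProd_leg13, charProd_leg23, hc.convChar_char] at this
    exact this

theorem rBichar_apply (hc : IsCharGroup H) (hR : H.IsUniversalRMatrix R) (g h : V) :
    (rBichar hc hR g h : k) = charProd (char k g) (char k h) R := rfl

theorem eq_diagonalTensor_rBichar (hc : IsCharGroup H) (hR : H.IsUniversalRMatrix R)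
    (h0 : (R : PathAlgebra k V ⊗[k] PathAlgebra k V) ∈ tensorSub (grade k V 0) (grade k V 0)) :
    (R : PathAlgebra k V ⊗[k] PathAlgebra k V) =
      diagonalTensor fun g h => (rBichar hc hR g h : k) :=
  eq_diagonalTensor h0

theorem IsCharGroup.vertex_mul_shift (hc : IsCharGroup H) (hH : H.IsGraded (grade k V)) (g : V)
    {t : V} {a : PathAlgebra k V} (ha : vertex k t * a = a) :
    vertex k (g⁻¹ * t) * shift H g a = shift H g a := by
  rw [← hc.shift_vertex hH, ← map_mul, ha]

theorem IsCharGroup.shift_mul_vertex (hc : IsCharGroup H) (hH : H.IsGraded (grade k V)) (g : V)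
    {s : V} {a : PathAlgebra k V} (ha : a * vertex k s = a) :
    shift H g a * vertex k (g⁻¹ * s) = shift H g a := by
  rw [← hc.shift_vertex hH, ← map_mul, ha]

/-- The right translation in terms of the left translation. -/
theorem evalRight_comul (hc : IsCharGroup H) (hH : H.IsGraded (grade k V))
    (hR : H.IsUniversalRMatrix R) {χ : V →* V →* kˣ}
    (hχ : (R : PathAlgebra k V ⊗[k] PathAlgebra k V) = diagonalTensor fun g h => (χ g h : k))
    (g : V) {s t : V} {a : PathAlgebra k V} (ht : vertex k t * a = a) (hs : a * vertex k s = a) :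
    evalRight (char k g) _ (H.comul a) = (χ g (t * s⁻¹) : k) • shift H g a := by
  -- With r = ∑ χ(g, h) e_h this reads (right translate) · r = r · (left translate). The left
  -- translate runs from g⁻¹s to g⁻¹t, so r acts on its two sides by χ(g, g⁻¹s) and χ(g, g⁻¹t),
  -- whose quotient is χ(g, ts⁻¹).
  have h := congrArg (evalLeft (char k g) _) (comm_comul_mul hR a)
  have hu : IsUnit (evalLeft (char k g) _ (R : PathAlgebra k V ⊗[k] PathAlgebra k V)) :=
    R.isUnit.map _
  rw [← hu.mul_left_inj]
  rw [map_mul, map_mul, evalLeft_comm] at h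
  rw [h, hχ, evalLeft_diagonalTensor, smul_mul_assoc,
    mul_sum_smul_vertex _ (hc.shift_mul_vertex hH g hs), smul_smul]
  refine (sum_smul_vertex_mul _ (hc.vertex_mul_shift hH g ht)).trans ?_
  rw [← Units.val_mul, ← map_mul, mul_left_comm, inv_mul_cancel_right]

end RMatrix

/-! ### Skew-symmetry from connectedness -/

section Skew

variable {k : Type u} [Field k] {V : Type v} [Quiver.{w} V] [Fintype V] [CommGroup V]
  {H : HopfStructure k (PathAlgebra k V)} {R : (PathAlgebra k V ⊗[k] PathAlgebra k V)ˣ}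

/-- The other contraction of quasi-cocommutativity compares the same two translates through χ(·, g).
Combined with `evalRight_comul` it gives a scalar equation on the shifted arrow, which is nonzero
because shifts are injective. -/
theorem skew_of_arrow (hc : IsCharGroup H) (hH : H.IsGraded (grade k V))
    (hR : H.IsUniversalRMatrix R) {χ : V →* V →* kˣ}
    (hχ : (R : PathAlgebra k V ⊗[k] PathAlgebra k V) = diagonalTensor fun g h => (χ g h : k))
    (g : V) (e : QArrow V) : χ g (arrowDegree e) * χ (arrowDegree e) g = 1 := by
  have h := congrArg (evalRight (char k g) _) (comm_comul_mul hR (arrow k e))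
  have h0 : shift H g (arrow k e) ≠ 0 := by
    rw [← map_zero (shift H g)]
    exact (hc.shift_injective g).ne (linearIndependent_arrow.ne_zero e)
  rw [map_mul, map_mul, evalRight_comm,
    evalRight_comul hc hH hR hχ g (tgt_mul_arrow e) (arrow_mul_src e), hχ,
    evalRight_diagonalTensor, mul_smul_comm] at h
  have h1 := (mul_sum_smul_vertex (fun h => (χ h g : k))
    (hc.shift_mul_vertex hH g (arrow_mul_src e))).symm.trans h
  rw [sum_smul_vertex_mul _ (hc.vertex_mul_shift hH g (tgt_mul_arrow e)), smul_smul] at h1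
  have h2 := smul_left_injective k h0 h1
  rw [← Units.val_mul, Units.val_inj] at h2
  have h3 : g⁻¹ * e.tgt = arrowDegree e * (g⁻¹ * e.src) := by
    rw [arrowDegree, mul_left_comm, inv_mul_cancel_right]
  rw [h3, map_mul χ (arrowDegree e), MonoidHom.mul_apply, ← mul_assoc] at h2
  exact right_eq_mul.1 h2

theorem skew_of_connected (hconn : IsConnectedQuiver V) (hc : IsCharGroup H)
    (hH : H.IsGraded (grade k V)) (hR : H.IsUniversalRMatrix R) {χ : V →* V →* kˣ}
    (hχ : (R : PathAlgebra k V ⊗[k] PathAlgebra k V) = diagonalTensor fun g h => (χ g h : k))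
    (g h : V) : χ g h * χ h g = 1 := by
  -- The h that satisfy the relation against every g form a subgroup. It contains the degree of each
  -- arrow, and an unoriented path from 1 to h writes h as a product of degrees and their inverses.
  let K : Subgroup V :=
    { carrier := {h | ∀ g, χ g h * χ h g = 1}
      one_mem' := fun g => by simp
      mul_mem' := fun {a b} ha hb g => by
        rw [map_mul, map_mul, MonoidHom.mul_apply, mul_mul_mul_comm, ha, hb, one_mul]
      inv_mem' := fun {a} ha g => by
        rw [map_inv, map_inv, MonoidHom.inv_apply, ← mul_inv, ha, inv_one] }
  have hK : ∀ e : QArrow V, arrowDegree e ∈ K := fun e g => skew_of_arrow hc hH hR hχ g e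
  have hpath : ∀ (a b : V) (p : @Quiver.Path (Quiver.Symmetrify V) _ a b), b * a⁻¹ ∈ K := by
    intro a b p
    induction p with
    | nil => rw [mul_inv_cancel]; exact K.one_mem
    | @cons b c p e ih =>
      have hbc : (c * b⁻¹ : V) ∈ K := by
        obtain e | e := e
        · exact hK ⟨b, c, e⟩
        · rw [← K.inv_mem_iff, mul_inv_rev, inv_inv]
          exact hK ⟨c, b, e⟩
      have := K.mul_mem hbc ih
      rwa [mul_assoc, inv_mul_cancel_left] at this
  obtain ⟨p⟩ := hconn.2 1 h
  have := hpath _ _ p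
  rw [inv_one, mul_one] at this
  exact this g

end Skew

/-! ### Isomorphism of structures with the same bicharacter -/

section Transfer

variable {k : Type u} [CommRing k] {V : Type v} [Quiver.{w} V] [Fintype V] [CommGroup V]
  {H H' : HopfStructure k (PathAlgebra k V)}

/-- The image of an arrow under the isomorphism between two Hopf structures on a path algebra: the
arrow is translated to the unit by the first structure, and back by the second one. -/
def transferArrow (H H' : HopfStructure k (PathAlgebra k V)) (e : QArrow V) : PathAlgebra k V :=
  shift H' e.src⁻¹ (shift H e.src (arrow k e))

theorem tgt_mul_transferArrow (hc : IsCharGroup H) (hH : H.IsGraded (grade k V))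
    (hc' : IsCharGroup H') (hH' : H'.IsGraded (grade k V)) (e : QArrow V) :
    vertex k e.tgt * transferArrow H H' e = transferArrow H H' e := by
  have := hc'.vertex_mul_shift hH' e.src⁻¹ (hc.vertex_mul_shift hH e.src (tgt_mul_arrow e))
  rwa [inv_inv, mul_inv_cancel_left] at this

theorem transferArrow_mul_src (hc : IsCharGroup H) (hH : H.IsGraded (grade k V))
    (hc' : IsCharGroup H') (hH' : H'.IsGraded (grade k V)) (e : QArrow V) :
    transferArrow H H' e * vertex k e.src = transferArrow H H' e := by
  have := hc'.shift_mul_vertex hH' e.src⁻¹ (hc.shift_mul_vertex hH e.src (arrow_mul_src e))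
  rwa [inv_inv, mul_inv_cancel_left] at this

theorem isRep_transfer (hc : IsCharGroup H) (hH : H.IsGraded (grade k V))
    (hc' : IsCharGroup H') (hH' : H'.IsGraded (grade k V)) :
    IsRep (vertex k) (transferArrow H H') where
  mul_self := vertex_mul_self
  mul_of_ne v w h := by rw [vertex_mul_vertex, if_neg h]
  sum_eq_one := rfl
  tgt_mul := tgt_mul_transferArrow hc hH hc' hH'
  mul_src := transferArrow_mul_src hc hH hc' hH'

/-- The homomorphism between two graded Hopf structures on a path algebra with the same group of
vertices. -/
def transfer (hc : IsCharGroup H) (hH : H.IsGraded (grade k V))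
    (hc' : IsCharGroup H') (hH' : H'.IsGraded (grade k V)) :
    PathAlgebra k V →ₐ[k] PathAlgebra k V :=
  (isRep_transfer hc hH hc' hH').lift k

variable (hc : IsCharGroup H) (hH : H.IsGraded (grade k V))
    (hc' : IsCharGroup H') (hH' : H'.IsGraded (grade k V))

theorem transfer_vertex (v : V) : transfer hc hH hc' hH' (vertex k v) = vertex k v :=
  (isRep_transfer hc hH hc' hH').lift_vertex v

theorem transfer_arrow (e : QArrow V) :
    transfer hc hH hc' hH' (arrow k e) = shift H' e.src⁻¹ (shift H e.src (arrow k e)) :=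
  (isRep_transfer hc hH hc' hH').lift_arrow e

theorem transfer_arrow_mem (e : QArrow V) :
    transfer hc hH hc' hH' (arrow k e) ∈ grade k V 1 := by
  rw [transfer_arrow]
  exact shift_mem_grade hH' _ (shift_mem_grade hH _ (arrow_mem_grade e))

theorem transfer_mem_grade (n : ℕ) (a : PathAlgebra k V) (ha : a ∈ grade k V n) :
    transfer hc hH hc' hH' a ∈ grade k V n := by
  refine forall_mem_grade (transfer hc hH hc' hH').toLinearMap (grade k V) (fun v => ?_)
    (fun n e x hx => ?_) n a ha
  · rw [AlgHom.toLinearMap_apply, transfer_vertex]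
    exact vertex_mem_grade v
  · rw [AlgHom.toLinearMap_apply, map_mul, add_comm]
    exact grade_mul_mem (transfer_arrow_mem hc hH hc' hH' e) hx

/-- The value of the transfer homomorphism on the elements of degree one with source `s`. -/
theorem transfer_apply {s : V} {x : PathAlgebra k V} (hx : x ∈ grade k V 1)
    (hs : x * vertex k s = x) :
    transfer hc hH hc' hH' x = shift H' s⁻¹ (shift H s x) := by
  rw [← hs]
  clear hs
  rw [grade_one_eq] at hx
  induction hx using Submodule.span_induction with
  | zero => simp
  | add x y _ _ hx hy => simp only [add_mul, map_add, hx, hy]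
  | smul c x _ hx => simp only [smul_mul_assoc, map_smul, hx]
  | mem x h =>
    obtain ⟨e, rfl⟩ := h
    rw [arrow_mul_vertex]
    split_ifs with h
    · rw [transfer_arrow, h]
    · simp

/-- The shifted arrow has source g⁻¹ · source. Both sides bring the arrow to source 1 with `H` and
then to that vertex with `H'`. -/
theorem transfer_shift (g : V) (e : QArrow V) :
    transfer hc hH hc' hH' (shift H g (arrow k e)) =
      shift H' g (transfer hc hH hc' hH' (arrow k e)) := by
  rw [transfer_apply hc hH hc' hH' (shift_mem_grade hH g (arrow_mem_grade e))
    (hc.shift_mul_vertex hH g (arrow_mul_src e)), transfer_arrow, hc.shift_shift, hc'.shift_shift,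
    mul_inv_rev, inv_inv, mul_right_comm, inv_mul_cancel, one_mul, mul_comm]

theorem transfer_transfer (a : PathAlgebra k V) :
    transfer hc' hH' hc hH (transfer hc hH hc' hH' a) = a := by
  suffices h : (transfer hc' hH' hc hH).comp (transfer hc hH hc' hH') = AlgHom.id k _ from
    congrArg (fun F => F a) h
  refine algHom_ext (fun v => ?_) fun e => ?_
  · simp only [AlgHom.comp_apply, transfer_vertex, AlgHom.id_apply]
  · have h : transfer hc hH hc' hH' (arrow k e) * vertex k e.src =
        transfer hc hH hc' hH' (arrow k e) := by
      rw [← transfer_vertex hc hH hc' hH' e.src, ← map_mul, arrow_mul_src]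
    rw [AlgHom.comp_apply, transfer_apply hc' hH' hc hH (transfer_arrow_mem hc hH hc' hH' e) h,
      transfer_arrow, hc'.shift_shift, mul_inv_cancel, hc'.shift_one, hc.shift_inv_shift]
    rfl

/-- The isomorphism between two graded Hopf structures on a path algebra with the same group of
vertices. -/
def transferEquiv : PathAlgebra k V ≃ₐ[k] PathAlgebra k V :=
  AlgEquiv.ofAlgHom (transfer hc hH hc' hH') (transfer hc' hH' hc hH)
    (AlgHom.ext (transfer_transfer hc' hH' hc hH)) (AlgHom.ext (transfer_transfer hc hH hc' hH'))

theorem counit_transfer (a : PathAlgebra k V) :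
    H'.counit (transfer hc hH hc' hH' a) = H.counit a := by
  rw [hc.counit_eq, hc'.counit_eq]
  suffices h : (char k 1).comp (transfer hc hH hc' hH') = char k 1 from congrArg (fun F => F a) h
  refine algHom_ext (fun v => ?_) fun e => ?_
  · rw [AlgHom.comp_apply, transfer_vertex]
  · rw [AlgHom.comp_apply, char_arrow,
      char_grade 1 one_ne_zero (transfer_arrow_mem hc hH hc' hH' e)]

theorem comul_transfer (hv : ∀ v, H.comul (vertex k v) = comulVertex k v)
    (hv' : ∀ v, H'.comul (vertex k v) = comulVertex k v)
    {R R' : (PathAlgebra k V ⊗[k] PathAlgebra k V)ˣ} (hR : H.IsUniversalRMatrix R)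
    (hR' : H'.IsUniversalRMatrix R') {χ : V →* V →* kˣ}
    (hχ : (R : PathAlgebra k V ⊗[k] PathAlgebra k V) = diagonalTensor fun g h => (χ g h : k))
    (hχ' : (R' : PathAlgebra k V ⊗[k] PathAlgebra k V) = diagonalTensor fun g h => (χ g h : k))
    (a : PathAlgebra k V) :
    Algebra.TensorProduct.map (transfer hc hH hc' hH') (transfer hc hH hc' hH') (H.comul a) =
      H'.comul (transfer hc hH hc' hH' a) := by
  suffices h : (Algebra.TensorProduct.map (transfer hc hH hc' hH')
      (transfer hc hH hc' hH')).comp H.comul = H'.comul.comp (transfer hc hH hc' hH') from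
    congrArg (fun F => F a) h
  refine algHom_ext (fun v => ?_) fun e => ?_
  · simp only [AlgHom.comp_apply, transfer_vertex, hv, hv', comulVertex, map_sum,
      Algebra.TensorProduct.map_tmul]
  · have ht : vertex k e.tgt * transfer hc hH hc' hH' (arrow k e) =
        transfer hc hH hc' hH' (arrow k e) := by
      rw [← transfer_vertex hc hH hc' hH' e.tgt, ← map_mul, tgt_mul_arrow]
    have hs : transfer hc hH hc' hH' (arrow k e) * vertex k e.src =
        transfer hc hH hc' hH' (arrow k e) := by
      rw [← transfer_vertex hc hH hc' hH' e.src, ← map_mul, arrow_mul_src]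
    rw [AlgHom.comp_apply, AlgHom.comp_apply, comul_of_mem_grade_one hH (arrow_mem_grade e),
      comul_of_mem_grade_one hH' (transfer_arrow_mem hc hH hc' hH' e), map_sum]
    -- In degree one Δ is made of left and right translates. `transfer_shift` intertwines the left
    -- ones, and the right ones are the same χ-multiples of these for both structures.
    refine Finset.sum_congr rfl fun g _ => ?_
    rw [evalRight_comul hc hH hR hχ g (tgt_mul_arrow e) (arrow_mul_src e),
      evalRight_comul hc' hH' hR' hχ' g ht hs, map_add, Algebra.TensorProduct.map_tmul,
      Algebra.TensorProduct.map_tmul, map_smul, transfer_vertex, transfer_shift]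

theorem map_transfer_diagonalTensor (f : V → V → k) :
    Algebra.TensorProduct.map (transfer hc hH hc' hH') (transfer hc hH hc' hH')
      (diagonalTensor f) = diagonalTensor f := by
  simp only [diagonalTensor, map_sum, map_smul, Algebra.TensorProduct.map_tmul, transfer_vertex]

end Transfer

end PathAlgebra

/-! ### Classification by skew-symmetric bicharacters -/

namespace HopfQuiverStructure

open PathAlgebra

variable {k : Type u} [Field k] {G : Type v} [CommGroup G] [Fintype G] {S : ConjClasses G → ℕ}

theorem comul_vertex' (X : HopfQuiverStructure k G S) (v : HopfQuiver G S) :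
    X.hopf.comul (vertex k v) = comulVertex k v :=
  X.comul_vertex v

theorem isCharGroup (X : HopfQuiverStructure k G S) : IsCharGroup X.hopf where
  convChar_char v w := by
    classical
    refine algHom_ext (fun x => ?_) fun e => by
      rw [convChar_char_arrow X.isGraded, char_arrow]
    rw [HopfStructure.convChar, AlgHom.comp_apply, X.comul_vertex', comulVertex, map_sum,
      Finset.sum_eq_single v]
    · simp only [charProd_tmul, char_vertex, inv_mul_eq_iff_eq_mul, if_pos, one_mul]
    · intro b _ hb
      rw [charProd_tmul, char_vertex, if_neg hb, zero_mul]
    · simp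
  counit_eq := by
    refine algHom_ext (fun x => ?_) fun e => ?_
    · rw [char_vertex]
      split_ifs with h
      · subst h
        exact X.counit_vertex_one
      · exact X.counit_vertex_of_ne x h
    · rw [char_arrow]
      exact X.isGraded.counit_eq_zero 1 one_ne_zero _ (arrow_mem_grade e)

/-- The bicharacter of a graded quasitriangular structure. -/
def bichar (X : HopfQuiverStructure k G S) : HopfQuiver G S →* HopfQuiver G S →* kˣ :=
  rBichar X.isCharGroup X.isUniversalRMatrix

theorem R_eq (X : HopfQuiverStructure k G S) :
    (X.R : PathAlgebra k (HopfQuiver G S) ⊗[k] PathAlgebra k (HopfQuiver G S)) =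
      diagonalTensor fun g h => (X.bichar g h : k) :=
  eq_diagonalTensor_rBichar _ _ X.R_mem

/-- The skew-symmetric bicharacter of a graded quasitriangular structure on the path algebra of a
connected Hopf quiver. -/
def skewBichar (hconn : IsConnectedQuiver (HopfQuiver G S)) (X : HopfQuiverStructure k G S) :
    SkewBicharacter k G :=
  ⟨X.bichar, skew_of_connected hconn X.isCharGroup X.isGraded X.isUniversalRMatrix X.R_eq⟩

/-- An isomorphism that fixes the vertices fixes every diagonal tensor, so R itself is an invariant
of the class. -/
theorem bichar_eq_of_isIso {X Y : HopfQuiverStructure k G S}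
    {φ : PathAlgebra k (HopfQuiver G S) ≃ₐ[k] PathAlgebra k (HopfQuiver G S)}
    (h : IsIso X Y φ) : X.bichar = Y.bichar := by
  have hv (v : HopfQuiver G S) : φ (vertex k v) = vertex k v := h.map_vertex v
  have hR : (X.R : PathAlgebra k (HopfQuiver G S) ⊗[k] PathAlgebra k (HopfQuiver G S)) = Y.R := by
    rw [← h.map_R, X.R_eq]
    simp only [diagonalTensor, map_sum, map_smul, Algebra.TensorProduct.congr_apply,
      Algebra.TensorProduct.map_tmul, AlgEquiv.coe_toAlgHom, hv]
  ext g l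
  rw [bichar, bichar, rBichar_apply, rBichar_apply, hR]

theorem comul_transferEquiv {X Y : HopfQuiverStructure k G S} (h : X.bichar = Y.bichar)
    (a : PathAlgebra k (HopfQuiver G S)) :
    Algebra.TensorProduct.map (transfer X.isCharGroup X.isGraded Y.isCharGroup Y.isGraded)
      (transfer X.isCharGroup X.isGraded Y.isCharGroup Y.isGraded) (X.hopf.comul a) =
      Y.hopf.comul (transfer X.isCharGroup X.isGraded Y.isCharGroup Y.isGraded a) :=
  comul_transfer X.isCharGroup X.isGraded Y.isCharGroup Y.isGraded X.comul_vertex' Y.comul_vertex'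
    X.isUniversalRMatrix Y.isUniversalRMatrix X.R_eq (h ▸ Y.R_eq) a

theorem isIso_transferEquiv {X Y : HopfQuiverStructure k G S} (h : X.bichar = Y.bichar) :
    IsIso X Y (transferEquiv X.isCharGroup X.isGraded Y.isCharGroup Y.isGraded) where
  map_grade n := by
    refine le_antisymm ?_ fun a ha => ?_
    · rintro _ ⟨a, ha, rfl⟩
      exact transfer_mem_grade X.isCharGroup X.isGraded Y.isCharGroup Y.isGraded n a ha
    · exact ⟨_, transfer_mem_grade Y.isCharGroup Y.isGraded X.isCharGroup X.isGraded n a ha,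
        transfer_transfer Y.isCharGroup Y.isGraded X.isCharGroup X.isGraded a⟩
  map_vertex g := transfer_vertex X.isCharGroup X.isGraded Y.isCharGroup Y.isGraded _
  map_comul := comul_transferEquiv h
  map_counit := counit_transfer X.isCharGroup X.isGraded Y.isCharGroup Y.isGraded
  map_antipode := HopfStructure.map_antipode _ _
    (transfer X.isCharGroup X.isGraded Y.isCharGroup Y.isGraded) (comul_transferEquiv h)
    (counit_transfer X.isCharGroup X.isGraded Y.isCharGroup Y.isGraded)
  map_R := by
    rw [X.R_eq, Y.R_eq, ← h]
    exact map_transfer_diagonalTensor X.isCharGroup X.isGraded Y.isCharGroup Y.isGraded _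

/-- The graded quasitriangular structure on the path algebra of a Hopf quiver given by a
skew-symmetric bicharacter. -/
def ofSkewBicharacter (S : ConjClasses G → ℕ) (χ : SkewBicharacter k G) :
    HopfQuiverStructure k G S where
  toGradedQuasitriangular := bicharStructure (V := HopfQuiver G S) χ.1 χ.2
  comul_vertex g := comulHom_vertex (V := HopfQuiver G S) χ.1 g
  counit_vertex_one := (char_vertex (1 : HopfQuiver G S) 1).trans (if_pos rfl)
  counit_vertex_of_ne g hg := (char_vertex (1 : HopfQuiver G S) g).trans (if_neg hg)
  antipode_vertex g := antipodeMap_vertex (V := HopfQuiver G S) χ.1 g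
  R_mem := by
    change diagonalTensor (V := HopfQuiver G S) _ ∈ _
    refine sum_mem fun g _ => sum_mem fun h _ => Submodule.smul_mem _ _
      ⟨⟨_, vertex_mem_grade g⟩ ⊗ₜ ⟨_, vertex_mem_grade h⟩, ?_⟩
    rw [TensorProduct.map_tmul]
    rfl

theorem bichar_ofSkewBicharacter (χ : SkewBicharacter k G) (g h : HopfQuiver G S) :
    (ofSkewBicharacter S χ).bichar g h = χ.1 g h := by
  classical
  ext
  rw [bichar, rBichar_apply]
  change charProd (char k g) (char k h)
    (diagonalTensor fun g h : HopfQuiver G S => (χ.1 g h : k)) = _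
  simp [diagonalTensor, char_vertex]

end HopfQuiverStructure

end

theorem theorem4p4 {k : Type u} [Field k] :
    (∀ (V : Type v) [Quiver.{w} V] [Fintype V] [∀ a b : V, Finite (a ⟶ b)],
      Nonempty (GradedQuasitriangular k V) ↔
        ∃ (G : Type v) (_ : CommGroup G) (S : ConjClasses G → ℕ),
          Nonempty (QuiverIso V (HopfQuiver G S))) ∧
    (∀ (G : Type v) [CommGroup G] [Fintype G] (S : ConjClasses G → ℕ),
      IsConnectedQuiver (HopfQuiver G S) →
        ∃ Φ : Quotient (HopfQuiverStructure.isoSetoid k G S) ≃ SkewBicharacter k G,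
          ∀ X : HopfQuiverStructure k G S,
            (X.R : PathAlgebra k (HopfQuiver G S) ⊗[k] PathAlgebra k (HopfQuiver G S)) =
              ∑ g : G, ∑ h : G,
                (((Φ (Quotient.mk _ X)).1 g h : kˣ) : k) •
                  (eVert k S g ⊗ₜ[k] eVert k S h)) := by
  refine ⟨fun V _ _ _ => nonempty_gradedQuasitriangular_iff V, fun G _ _ S hconn => ?_⟩
  refine ⟨Equiv.ofBijective (Quotient.lift (HopfQuiverStructure.skewBichar hconn) fun X Y ⟨φ, h⟩ =>
    Subtype.ext (HopfQuiverStructure.bichar_eq_of_isIso h)) ⟨?_, fun χ => ?_⟩, fun X => X.R_eq⟩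
  · rintro ⟨X⟩ ⟨Y⟩ h
    exact Quotient.sound ⟨_, HopfQuiverStructure.isIso_transferEquiv (congrArg Subtype.val h)⟩
  · refine ⟨Quotient.mk _ (HopfQuiverStructure.ofSkewBicharacter S χ), Subtype.ext ?_⟩
    ext g h
    exact congrArg Units.val (HopfQuiverStructure.bichar_ofSkewBicharacter χ g h)
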